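/- Let $O$ be the origin of $\mathbb{R}^2$, with polar coordinates $(r,\theta)$ and polar basis $e_r=(\cos\theta,\sin\theta)$, $e_\theta=(-\sin\theta,\cos\theta)$. Conventions. Tensor-valued distributions are dual to tensor-valued test functions. For a vector-valued distribution $V$, $\operatorname{Curl}V=\partial_1V_2-\partial_2V_1$; for a tensor-valued $T$, $(\operatorname{Curl}T)_i=\partial_1T_{i2}-\partial_2T_{i1}$. The degree of a (scalar-, vector- or tensor-valued) distribution $T$ at $O$ is $\deg T=\inf\{m\in\mathbb{R}:\lim_{\lambda\to0^+}\lambda^mT(\psi_\lambda)=0\text{ for every test function }\psi\}-2\in[-\infty,\infty]$, where $\psi_\lambda(x)=\lambda^{-2}\psi(x/\lambda)$. The singular support of $T$ is the smallest closed set off which $T$ is a smooth function. The determinant $\operatorname{Det}T$ of a symmetric tensor-valued distribution $T$ is defined when there is a scalar distribution $B$ with $\nabla\nabla B=T$ and $\deg(\nabla B)<0$, whose restriction to $\mathbb{R}^2\setminus\{O\}$ is a function $b$, locally integrable on $\mathbb{R}^2$ and smooth off $O$, such that $\nabla b\otimes\nabla b$ extends from $\mathbb{R}^2\setminus\{O\}$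 to a (necessarily unique) distribution $\nabla B\otimes\nabla B$ on $\mathbb{R}^2$ of negative degree; then $\operatorname{Det}T=-\tfrac12\operatorname{Curl}\operatorname{Curl}(\nabla B\otimes\nabla B)$. Lemma. Let $\Lambda\in\mathcal{D}'(\mathbb{R}^2,\mathrm{Sym})$ be a symmetric tensor-valued distribution with $\deg\Lambda<0$ and singular support exactly $\{O\}$, whose restriction to $\mathbb{R}^2\setminus\{O\}$, a smooth tensor field $\lambda$, satisfies $\lambda(x)\neq0$ for all $x\neq O$. Then the following statements are equivalent: (i) $\operatorname{Det}\Lambda$ is defined, its restriction to $\mathbb{R}^2\setminus\{O\}$ is $0$, and $\operatorname{Curl}\Lambda=0$ on $\mathbb{R}^2$; (i$'$) $\det\lambda(x)=0$ for all $x\ne O$, and $\operatorname{Curl}\Lambda=0$ on $\mathbb{R}^2$; (ii) there is a smooth $2\pi$-periodic function $f$ with $\int_0^{2\pi}f(\theta)\,e_\theta\,d\theta=0$ and $$\Lambda(\psi)=\int_{\mathbb{R}^2}\Big\langle\frac{f(\theta)}{r}\,e_\theta\otimes e_\theta,\psi\Big\rangle\,da\quad\text{for all }\psi\in\mathcal{D}(\mathbb{R}^2,\mathrm{Lin});$$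 (iii) there are smooth $2\pi$-periodic functions $f,g$ with $g+g''=f$ and a distribution $W$ with $\Lambda=\nabla\nabla W$ and $W(\psi)=\int_{\mathbb{R}^2}w\,\psi\,da$ for all $\psi\in\mathcal{D}(\mathbb{R}^2)$, where $w=r\,g(\theta)$. Moreover, for every smooth $2\pi$-periodic $f$, the assertion in (ii) holds with this $f$ if and only if the assertion in (iii) holds with this $f$. -/

import Mathlib

open Set Filter Topology MeasureTheory TopologicalSpace
open scoped ContDiff Distributions LineDeriv

noncomputable section

namespace ConicalPlate

/-- The Euclidean plane `ℝ²`; the point `O` is the origin. -/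
abbrev Plane := EuclideanSpace ℝ (Fin 2)

/-- `𝓓(ℝ²)`: smooth compactly supported scalar functions. -/
abbrev Test := 𝓓((⊤ : Opens Plane), ℝ)

/-- `𝓓'(ℝ²)`: scalar distributions. -/
abbrev Dist := 𝓓'((⊤ : Opens Plane), ℝ)

/-- `𝓓'(ℝ², ℝ²)`, through components: the dual of the space `Fin 2 → Test` of vector valued test
functions. -/
abbrev VectorDist := Fin 2 → Dist

/-- `𝓓'(ℝ², Lin)`, through components: the dual of the space `Matrix (Fin 2) (Fin 2) Test` of
tensor valued test functions. It is `Sym` valued when `Matrix.IsSymm` holds. -/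
abbrev TensorDist := Matrix (Fin 2) (Fin 2) Dist

/-- The value `T(ψ)` of a distribution with components `T i` at a test function with components
`ψ i`. -/
def pairing {ι : Type*} [Fintype ι] (T : ι → Dist) (ψ : ι → Test) : ℝ := ∑ i, T i (ψ i)

/-- The value `T(ψ)` of a tensor valued distribution at a tensor valued test function. -/
def tensorPairing (T : TensorDist) (ψ : Matrix (Fin 2) (Fin 2) Test) : ℝ :=
  pairing (fun p : Fin 2 × Fin 2 => T p.1 p.2) (fun p => ψ p.1 p.2)

/-- The fixed orthonormal basis of the plane. -/
def e (i : Fin 2) : Plane := EuclideanSpace.single i 1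

/-! ### Differential operators on distributions -/

/-- The gradient of a scalar distribution. -/
def grad (B : Dist) : VectorDist := fun i => ∂_{e i} B

/-- The Hessian `∇∇B` of a scalar distribution. -/
def hess (B : Dist) : TensorDist := fun i j => ∂_{e j} (grad B i)

/-- The (scalar) curl of a vector valued distribution, `∂₁V₂ - ∂₂V₁`. -/
def vectorCurl (V : VectorDist) : Dist := ∂_{e 0} (V 1) - ∂_{e 1} (V 0)

/-- The curl of a tensor valued distribution: `⟨Curl T, a⟩ = Curl (Tᵀ a)` for all constant `a`,
that is, the curl is taken row by row. -/
def tensorCurl (T : TensorDist) : VectorDist := fun i => vectorCurl (T i)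

/-! ### Degree of a distribution at the origin -/

/-- The rescaled test function `x ↦ l⁻² φ(x / l)` (which is `0` for `l = 0`). -/
def dilate (l : ℝ) (φ : Test) : Test where
  toFun x := (l ^ 2)⁻¹ * φ (l⁻¹ • x)
  contDiff' := contDiff_const.mul (φ.contDiff.comp (contDiff_const_smul _))
  hasCompactSupport' := by
    rcases eq_or_ne l 0 with rfl | hl
    · have h : (fun x : Plane => ((0 : ℝ) ^ 2)⁻¹ * φ ((0 : ℝ)⁻¹ • x)) = 0 := by
        funext x
        simp
      rw [h]
      exact HasCompactSupport.zero
    · exact HasCompactSupport.mul_left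
        (φ.hasCompactSupport.comp_homeomorph (Homeomorph.smulOfNeZero l⁻¹ (inv_ne_zero hl)))
  tsupport_subset' := by simp

/-- The degree of a distribution with components `T i` with respect to the origin:
the infimum of all real `m` such that `l ^ m T(ψ_l) → 0` as `l → 0⁺` for every test function `ψ`,
minus `2`. It is an extended real number. -/
def degree {ι : Type*} [Fintype ι] (T : ι → Dist) : EReal :=
  sInf ((fun m : ℝ => (m : EReal)) '' {m : ℝ | ∀ ψ : ι → Test,
    Tendsto (fun l : ℝ => l ^ m * pairing T (fun i => dilate l (ψ i))) (𝓝[>] 0) (𝓝 0)}) - 2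

/-- The degree of a tensor valued distribution with respect to the origin. -/
def tensorDegree (T : TensorDist) : EReal := degree (fun p : Fin 2 × Fin 2 => T p.1 p.2)

/-! ### Restrictions, singular support -/

/-- The restriction of the scalar distribution `T` to the open set `U` is the function `t`, smooth
on `U`. -/
def HasSmoothDensityOn (T : Dist) (U : Set Plane) (t : Plane → ℝ) : Prop :=
  ContDiffOn ℝ ∞ t U ∧ ∀ φ : Test, tsupport φ ⊆ U → T φ = ∫ x, t x * φ x

/-- The restriction of the tensor valued distribution `T` to the open set `U` is the tensor field
`t`, smooth on `U`. -/
def HasSmoothTensorDensityOn (T : TensorDist) (U : Set Plane)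
    (t : Plane → Matrix (Fin 2) (Fin 2) ℝ) : Prop :=
  ∀ i j, HasSmoothDensityOn (T i j) U (fun x => t x i j)

/-- The set `C` is the singular support of `T`: the smallest closed set such that the restriction
of `T` to its complement is smooth. -/
def IsSingularSupport (T : TensorDist) (C : Set Plane) : Prop :=
  IsLeast {K : Set Plane | IsClosed K ∧ ∃ t, HasSmoothTensorDensityOn T Kᶜ t} C

/-! ### The distributional determinant -/

/-- The tensor field `∇b ⊗ ∇b`. -/
def gradDyad (b : Plane → ℝ) (x : Plane) : Matrix (Fin 2) (Fin 2) ℝ :=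
  Matrix.of fun i j => fderiv ℝ b x (e i) * fderiv ℝ b x (e j)

/-- `Det T` is defined and equal to `D`: there is a scalar distribution `B`, with a locally
integrable bulk density `b` smooth away from the origin, such that `∇∇B = T`, `deg ∇B < 0`, the
field `∇b ⊗ ∇b` on the punctured plane extends to a distribution `P` on the plane with `deg P < 0`
(such an extension is unique), and `D = ½ [B, B]`, where `[B, B] = - Curl Curl P`. -/
def IsDet (T : TensorDist) (D : Dist) : Prop :=
  ∃ (B : Dist) (b : Plane → ℝ) (P : TensorDist),
    LocallyIntegrable b ∧ HasSmoothDensityOn B {0}ᶜ b ∧ hess B = T ∧ degree (grad B) < 0 ∧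
    HasSmoothTensorDensityOn P {0}ᶜ (gradDyad b) ∧ tensorDegree P < 0 ∧
    D = (1 / 2 : ℝ) • (-vectorCurl (tensorCurl P))

/-! ### Polar coordinates and conical fields -/

/-- The polar angle, in `(-π, π]`; it only enters through `2π`-periodic functions. -/
def angle (x : Plane) : ℝ := Complex.arg ⟨x 0, x 1⟩

/-- The angular unit vector at polar angle `θ`. -/
def eTheta (θ : ℝ) : Fin 2 → ℝ := ![-Real.sin θ, Real.cos θ]

/-- `f` is a smooth function of the polar angle, that is, smooth and `2π`-periodic. -/
def IsSmoothPeriodic (f : ℝ → ℝ) : Prop := ContDiff ℝ ∞ f ∧ Function.Periodic f (2 * Real.pi)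

/-- `T = (f(θ)/r) e_θ ⊗ e_θ` as a distribution on the whole plane, and `∫₀^{2π} f e_θ dθ = 0`. -/
def HasConicalForm (T : TensorDist) (f : ℝ → ℝ) : Prop :=
  (∀ ψ : Matrix (Fin 2) (Fin 2) Test, tensorPairing T ψ =
    ∫ x : Plane, ∑ i, ∑ j,
      f (angle x) / ‖x‖ * (eTheta (angle x) i * eTheta (angle x) j) * ψ i j x) ∧
  ∀ i, ∫ θ in (0 : ℝ)..(2 * Real.pi), f θ * eTheta θ i = 0

/-- `T = ∇∇W`, where `W` is the distribution on the plane given by the function `w = r g(θ)`, with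
`g` smooth, `2π`-periodic and `g + g'' = f`. -/
def HasConicalPotential (T : TensorDist) (f : ℝ → ℝ) : Prop :=
  ∃ g : ℝ → ℝ, IsSmoothPeriodic g ∧ (∀ θ, g θ + iteratedDeriv 2 g θ = f θ) ∧
    ∃ W : Dist, (∀ φ : Test, W φ = ∫ x : Plane, ‖x‖ * g (angle x) * φ x) ∧ T = hess W

end ConicalPlate

end

/-! Away from `O` the distributional determinant is the pointwise one, because the third derivatives
in `-½ Curl Curl (∇b ⊗ ∇b)` cancel. Hence (i) gives (i').

Under (i') the field `lam` is symmetric, singular, nonzero and curl-free, locally the Hessian of a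
developable graph. Its kernel is constant along the line which it spans (`ker_of_segment`), so a
ruling can end only at `O`. Suppose that one ruling is not radial, so that its line misses `O`, and
take the closed half-plane that contains it and is bounded by its parallel through `O`. A ruling
issuing from this half-plane cannot cross the given one, so the half-plane is ruled in parallel. The
opposite open half-plane is ruled either in parallel or radially. The mixed case fails on the common
boundary: with `v` the parallel direction, one side gives `∂_v M = 0` and the other `∂_x M = -M`, so
by continuity `M = 0` at the point `v` (`radial_or_parallel`). Parallel rulings would make `Λ`
smooth across `O`, against the singular support. Radial rulings make the field homogeneous of degree
`-1`, that is, `(f(θ)/r) e_θ ⊗ e_θ`.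

Negative degree is what carries information across `O`: a distribution supported at `O` whose
rescalings tend to zero vanishes (`eq_zero_of_isVanishingOn_punctured`), so `Λ` equals its bulk
function. Then `Curl Λ = 0`, tested against a radial bump, says `∫ f e_θ = 0`, which is the
solvability condition of `g + g'' = f` among periodic functions. Conversely, for `W = r g(θ)`
homogeneity excludes any part of `∇∇W` concentrated at `O`, and `∇W ⊗ ∇W` has a bounded density of
degree zero, so the determinant is defined. -/

noncomputable section

namespace ConicalPlate

/-! ### Distributions given by functions -/

/-- The distribution `φ ↦ ∫ t φ` of a locally integrable function `t`. -/
def ofDensity (t : Plane → ℝ) : Dist :=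
  TestFunction.integralAgainstBilinCLM (ContinuousLinearMap.mul ℝ ℝ) volume t

lemma ofDensity_apply {t : Plane → ℝ} (ht : LocallyIntegrable t) (φ : Test) :
    ofDensity t φ = ∫ x, t x * φ x := by
  have h : LocallyIntegrableOn t ((⊤ : Opens Plane) : Set Plane) := ht.locallyIntegrableOn _
  refine (TestFunction.integralAgainstBilinCLM_eq_integral (B := ContinuousLinearMap.mul ℝ ℝ)
    h (f := φ)).trans ?_
  simp [mul_comm]

lemma integrable_mul_test {t : Plane → ℝ} (ht : LocallyIntegrable t) (φ : Test) :
    Integrable (fun x => t x * φ x) := by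
  have h : LocallyIntegrableOn t ((⊤ : Opens Plane) : Set Plane) := ht.locallyIntegrableOn _
  simpa [mul_comm] using TestFunction.integrable_bilin (ContinuousLinearMap.mul ℝ ℝ) h φ

lemma test_contDiff (φ : Test) : ContDiff ℝ ∞ φ := φ.contDiff

lemma test_differentiable (φ : Test) : Differentiable ℝ φ :=
  (test_contDiff φ).differentiable (by simp)

lemma lineDeriv_test_apply (φ : Test) (v x : Plane) : (∂_{v} φ) x = fderiv ℝ φ x v := by
  rw [TestFunction.lineDerivOp_eq_lineDerivCLM ℝ, TestFunction.lineDerivCLM_apply]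
  simp [(test_differentiable φ x).lineDeriv_eq_fderiv]

lemma lineDeriv_dist_apply (T : Dist) (v : Plane) (φ : Test) : (∂_{v} T) φ = -T (∂_{v} φ) := by
  rw [Distribution.lineDerivOp_apply_apply, map_neg]

lemma tsupport_lineDeriv_subset (φ : Test) (v : Plane) : tsupport (∂_{v} φ : Test) ⊆ tsupport φ := by
  refine Subset.trans ?_ (tsupport_fderiv_subset ℝ (f := φ))
  refine closure_mono fun x hx => ?_
  rw [Function.mem_support, lineDeriv_test_apply] at hx
  intro h
  exact hx (by rw [h]; rfl)

lemma lineDeriv_comm_test (φ : Test) (v w : Plane) : ∂_{v} (∂_{w} φ) = ∂_{w} (∂_{v} φ) := by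
  ext x
  have h : ∀ a b : Plane, (∂_{a} (∂_{b} φ)) x = fderiv ℝ (fderiv ℝ φ) x a b := by
    intro a b
    rw [lineDeriv_test_apply]
    have : ⇑(∂_{b} φ : Test) = fun y => fderiv ℝ φ y b :=
      funext fun y => lineDeriv_test_apply φ b y
    rw [this]
    have hd : DifferentiableAt ℝ (fderiv ℝ φ) x :=
      ((test_contDiff φ).fderiv_right (m := 1) (by norm_cast)).differentiable (by simp) x
    rw [fderiv_clm_apply hd (differentiableAt_const _)]
    simp
  rw [h, h]
  exact ((test_contDiff φ).contDiffAt.isSymmSndFDerivAt (by simpa using ENat.LEInfty.out)).eq v w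

lemma lineDeriv_comm_dist (T : Dist) (v w : Plane) : ∂_{v} (∂_{w} T) = ∂_{w} (∂_{v} T) := by
  ext φ
  simp only [lineDeriv_dist_apply, neg_neg, lineDeriv_comm_test φ v w]

lemma tensorCurl_hess (B : Dist) : tensorCurl (hess B) = 0 := by
  funext i
  simp only [tensorCurl, vectorCurl, hess, Pi.zero_apply]
  rw [lineDeriv_comm_dist, sub_self]

/-! ### Smooth densities on open sets -/

section Density

variable {T S : Dist} {U : Set Plane} {t s : Plane → ℝ}

lemma integrable_mul_test_of_tsupport_subset (ht : ContDiffOn ℝ ∞ t U)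
    {φ : Test} (hφ : tsupport φ ⊆ U) : Integrable (fun x => t x * φ x) := by
  have hs : Function.support (fun x => t x * φ x) ⊆ tsupport φ := fun x hx =>
    subset_tsupport _ (fun h => hx (by simp [h]))
  rw [← integrableOn_iff_integrable_of_support_subset hs]
  exact ((ht.continuousOn.mono hφ).mul φ.continuous.continuousOn).integrableOn_compact
    φ.hasCompactSupport

lemma HasSmoothDensityOn.congr (h : HasSmoothDensityOn T U t) (hts : EqOn s t U) :
    HasSmoothDensityOn T U s := by
  refine ⟨h.1.congr hts, fun φ hφ => (h.2 φ hφ).trans (integral_congr_ae (.of_forall fun x => ?_))⟩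
  by_cases hx : x ∈ U
  · simp only [hts hx]
  · have : φ x = 0 := image_eq_zero_of_notMem_tsupport fun h => hx (hφ h)
    simp [this]

lemma HasSmoothDensityOn.sub (h : HasSmoothDensityOn T U t)
    (h' : HasSmoothDensityOn S U s) : HasSmoothDensityOn (T - S) U (fun x => t x - s x) := by
  refine ⟨h.1.sub h'.1, fun φ hφ => ?_⟩
  change T φ - S φ = _
  rw [h.2 φ hφ, h'.2 φ hφ, ← integral_sub (integrable_mul_test_of_tsupport_subset h.1 hφ)
    (integrable_mul_test_of_tsupport_subset h'.1 hφ)]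
  simp only [sub_mul]

lemma HasSmoothDensityOn.const_smul (h : HasSmoothDensityOn T U t) (c : ℝ) :
    HasSmoothDensityOn (c • T) U (fun x => c * t x) := by
  refine ⟨contDiffOn_const.mul h.1, fun φ hφ => ?_⟩
  change c • T φ = _
  rw [h.2 φ hφ, smul_eq_mul, ← integral_const_mul]
  simp only [mul_assoc]

lemma HasSmoothDensityOn.neg (h : HasSmoothDensityOn T U t) :
    HasSmoothDensityOn (-T) U (fun x => -t x) := by
  simpa using h.const_smul (-1)

lemma contDiffOn_fderiv_apply (hU : IsOpen U) (ht : ContDiffOn ℝ ∞ t U) (v : Plane) :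
    ContDiffOn ℝ ∞ (fun x => fderiv ℝ t x v) U :=
  (ht.fderiv_of_isOpen hU (by simp)).clm_apply contDiffOn_const

lemma HasSmoothDensityOn.lineDeriv (hU : IsOpen U) (h : HasSmoothDensityOn T U t) (v : Plane) :
    HasSmoothDensityOn (∂_{v} T) U (fun x => fderiv ℝ t x v) := by
  have hd := contDiffOn_fderiv_apply hU h.1 v
  refine ⟨hd, fun φ hφ => ?_⟩
  have hφ' := (tsupport_lineDeriv_subset φ v).trans hφ
  rw [lineDeriv_dist_apply, h.2 _ hφ']
  simp only [lineDeriv_test_apply]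
  rw [integral_mul_fderiv_eq_neg_fderiv_mul_of_integrable, neg_neg]
  · exact integrable_mul_test_of_tsupport_subset hd hφ
  · simpa only [lineDeriv_test_apply] using integrable_mul_test_of_tsupport_subset h.1 hφ'
  · exact integrable_mul_test_of_tsupport_subset h.1 hφ
  · exact fun x hx => (h.1.contDiffAt (hU.mem_nhds (hφ hx))).differentiableAt (by simp)
  · exact fun x _ => test_differentiable φ x

/-- The fundamental lemma of the calculus of variations gives vanishing almost everywhere, and
continuity upgrades it to every point of the open set. -/
lemma HasSmoothDensityOn.eqOn_zero (hU : IsOpen U) (h : HasSmoothDensityOn T U t)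
    (h0 : Distribution.IsVanishingOn T U) : EqOn t 0 U := by
  have hae : ∀ᵐ x, x ∈ U → t x = 0 := by
    refine hU.ae_eq_zero_of_integral_contDiff_smul_eq_zero
      (h.1.continuousOn.locallyIntegrableOn hU.measurableSet) fun g hg hc hs => ?_
    let φ : Test := ⟨g, hg, hc, by simp⟩
    have h1 := h.2 φ hs
    rw [h0 φ hs] at h1
    rw [h1]
    exact integral_congr_ae (.of_forall fun x => by simp [φ, mul_comm])
  have hr : t =ᵐ[volume.restrict U] 0 := (ae_restrict_iff' hU.measurableSet).2 hae
  exact Measure.eqOn_open_of_ae_eq hr hU h.1.continuousOn continuousOn_const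

lemma HasSmoothDensityOn.eqOn (hU : IsOpen U) (h : HasSmoothDensityOn T U t)
    (h' : HasSmoothDensityOn T U s) : EqOn t s U := by
  have h0 := (h.sub h').eqOn_zero hU (fun φ _ => by simp)
  exact fun x hx => sub_eq_zero.1 (h0 hx)

lemma HasSmoothDensityOn.isVanishingOn (h : HasSmoothDensityOn T U t) (h0 : EqOn t 0 U) :
    Distribution.IsVanishingOn T U := by
  intro φ hφ
  have h1 := (h.congr h0.symm).2 φ hφ
  rw [h1]
  simp

/-- The restriction of a tensor valued distribution determines its curl. -/
lemma HasSmoothTensorDensityOn.tensorCurl {T : TensorDist} {t : Plane → Matrix (Fin 2) (Fin 2) ℝ}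
    (hU : IsOpen U) (h : HasSmoothTensorDensityOn T U t) (i : Fin 2) :
    HasSmoothDensityOn (tensorCurl T i) U
      (fun x => fderiv ℝ (fun y => t y i 1) x (e 0) - fderiv ℝ (fun y => t y i 0) x (e 1)) :=
  ((h i 1).lineDeriv hU _).sub ((h i 0).lineDeriv hU _)

end Density

/-! ### The determinant away from the origin -/

lemma isOpen_punctured : IsOpen ({0}ᶜ : Set Plane) := isOpen_compl_singleton

/-- The mixed second derivatives of a smooth function on an open set agree. -/
lemma fderiv_fderiv_comm {b : Plane → ℝ} {U : Set Plane} (hU : IsOpen U)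
    (hb : ContDiffOn ℝ ∞ b U) {x : Plane} (hx : x ∈ U) (v w : Plane) :
    fderiv ℝ (fun y => fderiv ℝ b y v) x w = fderiv ℝ (fun y => fderiv ℝ b y w) x v := by
  have hbx : ContDiffAt ℝ ∞ b x := hb.contDiffAt (hU.mem_nhds hx)
  have hd : DifferentiableAt ℝ (fderiv ℝ b) x :=
    (hbx.fderiv_right (m := 1) (by norm_cast)).differentiableAt (by simp)
  rw [fderiv_clm_apply hd (differentiableAt_const _), fderiv_clm_apply hd (differentiableAt_const _)]
  simpa using (hbx.isSymmSndFDerivAt (by simpa using ENat.LEInfty.out)).eq w v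

/-- The identity `-½ Curl Curl (∇b ⊗ ∇b) = det ∇∇b` for smooth functions. -/
lemma neg_half_curl_curl_gradDyad {b : Plane → ℝ} {U : Set Plane} (hU : IsOpen U)
    (hb : ContDiffOn ℝ ∞ b U) {x : Plane} (hx : x ∈ U) :
    let c := fun (i : Fin 2) (x : Plane) => fderiv ℝ (fun y => gradDyad b y i 1) x (e 0) -
      fderiv ℝ (fun y => gradDyad b y i 0) x (e 1)
    (1 / 2 : ℝ) * -(fderiv ℝ (c 1) x (e 0) - fderiv ℝ (c 0) x (e 1)) =
      (Matrix.of fun i j => fderiv ℝ (fun y => fderiv ℝ b y (e i)) x (e j)).det := by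
  intro c
  set g : Fin 2 → Plane → ℝ := fun i y => fderiv ℝ b y (e i) with hg
  have hgs : ∀ i, ContDiffOn ℝ ∞ (g i) U := fun i => contDiffOn_fderiv_apply hU hb _
  have hgd : ∀ i, ∀ y ∈ U, DifferentiableAt ℝ (g i) y := fun i y hy =>
    ((hgs i).contDiffAt (hU.mem_nhds hy)).differentiableAt (by simp)
  set h : Fin 2 → Fin 2 → Plane → ℝ := fun i j y => fderiv ℝ (g i) y (e j) with hh
  have hhs : ∀ i j, ContDiffOn ℝ ∞ (h i j) U := fun i j => contDiffOn_fderiv_apply hU (hgs i) _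
  have hhd : ∀ i j, ∀ y ∈ U, DifferentiableAt ℝ (h i j) y := fun i j y hy =>
    ((hhs i j).contDiffAt (hU.mem_nhds hy)).differentiableAt (by simp)
  have hsymm : ∀ i j, ∀ y ∈ U, h i j y = h j i y := fun i j y hy =>
    fderiv_fderiv_comm hU hb hy _ _
  have hP : ∀ i j, ∀ y ∈ U, ∀ k, fderiv ℝ (fun y => gradDyad b y i j) y (e k) =
      g i y * h j k y + g j y * h i k y := by
    intro i j y hy k
    change fderiv ℝ (fun y => g i y * g j y) y (e k) = _
    rw [fderiv_fun_mul (hgd i y hy) (hgd j y hy)]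
    simp [hh]
  have hc : ∀ i, ∀ y ∈ U, c i y = g 1 y * h i 0 y - g 0 y * h i 1 y := by
    intro i y hy
    simp only [c]
    rw [hP i 1 y hy 0, hP i 0 y hy 1, hsymm 1 0 y hy]
    ring
  have hcd : ∀ i k, fderiv ℝ (c i) x (e k) = g 1 x * fderiv ℝ (h i 0) x (e k) + h i 0 x * h 1 k x -
      (g 0 x * fderiv ℝ (h i 1) x (e k) + h i 1 x * h 0 k x) := by
    intro i k
    have he : c i =ᶠ[𝓝 x] fun y => g 1 y * h i 0 y - g 0 y * h i 1 y :=
      Filter.eventually_of_mem (hU.mem_nhds hx) (hc i)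
    rw [he.fderiv_eq, fderiv_fun_sub ((hgd 1 x hx).fun_mul (hhd i 0 x hx))
      ((hgd 0 x hx).fun_mul (hhd i 1 x hx)), fderiv_fun_mul (hgd 1 x hx) (hhd i 0 x hx),
      fderiv_fun_mul (hgd 0 x hx) (hhd i 1 x hx)]
    simp [hh]
  have h3 : fderiv ℝ (h 1 0) x = fderiv ℝ (h 0 1) x :=
    Filter.EventuallyEq.fderiv_eq (Filter.eventually_of_mem (hU.mem_nhds hx) (hsymm 1 0))
  -- Third derivatives enter the double curl only through two differences, which vanish by the
  -- symmetry of second derivatives of `g 0` and `g 1`.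
  have hA : fderiv ℝ (h 1 0) x (e 0) = fderiv ℝ (h 0 0) x (e 1) := by
    rw [h3]
    exact fderiv_fderiv_comm hU (hgs 0) hx _ _
  have hB : fderiv ℝ (h 1 1) x (e 0) = fderiv ℝ (h 0 1) x (e 1) := by
    rw [← h3]
    exact fderiv_fderiv_comm hU (hgs 1) hx _ _
  rw [hcd, hcd, hA, hB, Matrix.det_fin_two]
  simp only [Matrix.of_apply]
  change _ = h 0 0 x * h 1 1 x - h 0 1 x * h 1 0 x
  rw [hsymm 1 0 x hx]
  ring

/-- Away from the origin, the distributional determinant is the pointwise one. -/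
lemma IsDet.hasSmoothDensityOn {T : TensorDist} {D : Dist} (h : IsDet T D)
    {t : Plane → Matrix (Fin 2) (Fin 2) ℝ} (ht : HasSmoothTensorDensityOn T {0}ᶜ t) :
    HasSmoothDensityOn D {0}ᶜ (fun x => (t x).det) := by
  obtain ⟨B, b, P, -, hB, hT, -, hP, -, rfl⟩ := h
  have hU := isOpen_punctured
  have h1 := ((((hP.tensorCurl hU 1).lineDeriv hU (e 0)).sub
    ((hP.tensorCurl hU 0).lineDeriv hU (e 1))).neg).const_smul (1 / 2 : ℝ)
  refine h1.congr fun x hx => ?_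
  have h2 := neg_half_curl_curl_gradDyad hU hB.1 hx
  simp only at h2 ⊢
  rw [h2]
  congr 1
  ext i j
  have h3 : HasSmoothDensityOn (T i j) {0}ᶜ
      (fun x => fderiv ℝ (fun y => fderiv ℝ b y (e i)) x (e j)) := by
    rw [← hT]
    exact (hB.lineDeriv hU _).lineDeriv hU _
  exact (ht i j).eqOn hU h3 hx

/-! ### Removable singularities of distributions -/

/-- The test function `x ↦ φ (2 x)`. -/
def halve (φ : Test) : Test := (1 / 4 : ℝ) • dilate (1 / 2) φ

lemma dilate_apply (l : ℝ) (φ : Test) (x : Plane) :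
    dilate l φ x = (l ^ 2)⁻¹ * φ (l⁻¹ • x) := rfl

lemma halve_apply (φ : Test) (x : Plane) : halve φ x = φ ((2 : ℝ) • x) := by
  change (1 / 4 : ℝ) * ((((1 / 2 : ℝ)) ^ 2)⁻¹ * φ ((1 / 2 : ℝ)⁻¹ • x)) = _
  norm_num
  ring

lemma halve_iterate_apply (n : ℕ) (φ : Test) (x : Plane) :
    halve^[n] φ x = φ ((2 : ℝ) ^ n • x) := by
  induction n generalizing φ with
  | zero => simp
  | succ n ih => rw [Function.iterate_succ_apply, ih, halve_apply, smul_smul, pow_succ']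

/-- The product of two test functions. -/
def mulTest (χ φ : Test) : Test where
  toFun x := χ x * φ x
  contDiff' := χ.contDiff.mul φ.contDiff
  hasCompactSupport' := χ.hasCompactSupport.mul_right
  tsupport_subset' := by simp

/-- All derivatives of order less than `k` vanish at the origin. -/
def IsFlat (k : ℕ) (φ : Test) : Prop := ∀ i < k, iteratedFDeriv ℝ i φ 0 = 0

lemma contDiff_nat (φ : Test) (i : ℕ) : ContDiff ℝ i φ :=
  (test_contDiff φ).of_le (by exact_mod_cast le_top)

lemma iteratedFDeriv_halve (φ : Test) (i : ℕ) (x : Plane) :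
    iteratedFDeriv ℝ i (halve φ) x = (2 : ℝ) ^ i • iteratedFDeriv ℝ i φ ((2 : ℝ) • x) := by
  have h : ⇑(halve φ) = fun z => φ ((2 : ℝ) • z) := funext (halve_apply φ)
  rw [h, iteratedFDeriv_comp_const_smul _ (contDiff_nat φ i)]

lemma iteratedFDeriv_halve_iterate (n : ℕ) (φ : Test) (i : ℕ) (x : Plane) :
    iteratedFDeriv ℝ i (halve^[n] φ) x =
      ((2 : ℝ) ^ n) ^ i • iteratedFDeriv ℝ i φ ((2 : ℝ) ^ n • x) := by
  have h : ⇑(halve^[n] φ) = fun z => φ ((2 : ℝ) ^ n • z) := funext (halve_iterate_apply n φ)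
  rw [h, iteratedFDeriv_comp_const_smul _ (contDiff_nat φ i)]

lemma IsFlat.halve {k : ℕ} {φ : Test} (h : IsFlat k φ) : IsFlat k (halve φ) := by
  intro i hi
  rw [iteratedFDeriv_halve, smul_zero, h i hi, smul_zero]

/-- On the leading derivatives, those of order `k`, halving acts at the origin as multiplication by
`2 ^ k`; subtracting this multiple gains one order of flatness. -/
lemma IsFlat.halve_sub {k : ℕ} {φ : Test} (h : IsFlat k φ) :
    IsFlat (k + 1) (ConicalPlate.halve φ - (2 : ℝ) ^ k • φ) := by
  intro i hi
  have h1 : iteratedFDeriv ℝ i (⇑(ConicalPlate.halve φ - (2 : ℝ) ^ k • φ)) 0 =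
      iteratedFDeriv ℝ i (ConicalPlate.halve φ) 0 - (2 : ℝ) ^ k • iteratedFDeriv ℝ i φ 0 := by
    have e1 : ⇑(ConicalPlate.halve φ - (2 : ℝ) ^ k • φ) =
        ⇑(ConicalPlate.halve φ) - (2 : ℝ) ^ k • ⇑φ := rfl
    have h2 : ContDiffAt ℝ i ((2 : ℝ) ^ k • ⇑φ) 0 :=
      ((contDiff_nat φ i).const_smul ((2 : ℝ) ^ k)).contDiffAt
    rw [e1, iteratedFDeriv_sub_apply (contDiff_nat _ i).contDiffAt h2,
      iteratedFDeriv_const_smul_apply (contDiff_nat φ i).contDiffAt]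
  rw [h1, iteratedFDeriv_halve, smul_zero]
  rcases Nat.lt_succ_iff_lt_or_eq.1 hi with hi | rfl
  · rw [h i hi]
    simp
  · rw [sub_self]

lemma exists_iteratedFDeriv_bound (φ : Test) (i : ℕ) :
    ∃ C, 0 ≤ C ∧ ∀ x, ‖iteratedFDeriv ℝ i φ x‖ ≤ C := by
  have hc : Continuous (iteratedFDeriv ℝ i φ) := (contDiff_nat φ i).continuous_iteratedFDeriv le_rfl
  obtain ⟨C, hC⟩ := hc.bounded_above_of_compact_support (φ.hasCompactSupport.iteratedFDeriv i)
  exact ⟨C, (norm_nonneg _).trans (hC 0), hC⟩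

/-- Taylor's estimate, by descending from the order `k` with the mean value inequality on the ball
of radius `‖x‖`. One constant, a bound for the derivative of order `k`, serves all lower orders. -/
lemma IsFlat.exists_bound {k : ℕ} {φ : Test} (h : IsFlat k φ) :
    ∃ C, 0 ≤ C ∧ ∀ i j, i + j = k → ∀ x, ‖iteratedFDeriv ℝ i φ x‖ ≤ C * ‖x‖ ^ j := by
  obtain ⟨C, hC0, hC⟩ := exists_iteratedFDeriv_bound φ k
  refine ⟨C, hC0, fun i j => ?_⟩
  induction j generalizing i with
  | zero =>
    intro hij x
    obtain rfl : i = k := by omega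
    simpa using hC x
  | succ j ih =>
    intro hij x
    have hd : ∀ y ∈ Metric.closedBall (0 : Plane) ‖x‖,
        DifferentiableAt ℝ (iteratedFDeriv ℝ i φ) y := fun y _ =>
      ((test_contDiff φ).differentiable_iteratedFDeriv (by exact_mod_cast ENat.natCast_lt_top i)) y
    have hb : ∀ y ∈ Metric.closedBall (0 : Plane) ‖x‖,
        ‖fderiv ℝ (iteratedFDeriv ℝ i φ) y‖ ≤ C * ‖x‖ ^ j := by
      intro y hy
      rw [norm_fderiv_iteratedFDeriv]
      refine (ih (i + 1) (by omega) y).trans ?_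
      rw [mem_closedBall_zero_iff] at hy
      gcongr
    have := (convex_closedBall (0 : Plane) ‖x‖).norm_image_sub_le_of_norm_fderiv_le hd hb
      (Metric.mem_closedBall_self (norm_nonneg _)) (y := x) (by simp)
    rw [h i (by omega), sub_zero, sub_zero] at this
    rwa [pow_succ, ← mul_assoc]

/-- A distribution has finite order on the closed unit ball. -/
lemma exists_order (R : Dist) : ∃ (N : ℕ) (C : ℝ), 0 ≤ C ∧ ∀ (φ : Test) (ε : ℝ), 0 ≤ ε →
    tsupport φ ⊆ Metric.closedBall 0 1 → (∀ i ≤ N, ∀ x, ‖iteratedFDeriv ℝ i φ x‖ ≤ ε) →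
    |R φ| ≤ C * ε := by
  let K : Compacts Plane := ⟨Metric.closedBall 0 1, isCompact_closedBall _ _⟩
  have hK : (K : Set Plane) ⊆ ((⊤ : Opens Plane) : Set Plane) := by simp
  let A : 𝓓_{K}(Plane, ℝ) →ₗ[ℝ] ℝ :=
    { toFun := fun f => R (TestFunction.ofSupportedIn hK f)
      map_add' := fun f g => map_add R (TestFunction.ofSupportedIn hK f) (TestFunction.ofSupportedIn hK g)
      map_smul' := fun c f => map_smul R c (TestFunction.ofSupportedIn hK f) }
  have hA : Continuous A := R.continuous.comp (TestFunction.continuous_ofSupportedIn hK)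
  obtain ⟨s, C, -, hsC⟩ := Seminorm.bound_of_continuous
    (ContDiffMapSupportedIn.withSeminorms ℝ Plane ℝ ⊤ K) ((normSeminorm ℝ ℝ).comp A)
    (continuous_norm.comp hA)
  -- Continuity on test functions supported in the ball bounds `R` by finitely many seminorms,
  -- indexed by `s`; the largest index is the order.
  refine ⟨s.sup id, C, C.2, fun φ ε hε hφ hb => ?_⟩
  let f : 𝓓_{K}(Plane, ℝ) := .of_support_subset φ.contDiff ((subset_tsupport _).trans hφ)
  have h1 := hsC f
  have h2 : TestFunction.ofSupportedIn hK f = φ := by ext x; rfl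
  have h3 : ((normSeminorm ℝ ℝ).comp A) f = |R φ| := by
    change ‖R (TestFunction.ofSupportedIn hK f)‖ = _
    rw [h2, Real.norm_eq_abs]
  rw [h3] at h1
  refine h1.trans ?_
  change (C : ℝ) * _ ≤ _
  refine mul_le_mul_of_nonneg_left ?_ C.2
  refine Seminorm.finset_sup_apply_le hε fun i hi => ?_
  rw [ContDiffMapSupportedIn.seminorm_top_le_iff ℝ hε]
  exact fun x _ => hb i (Finset.le_sup (f := id) hi) x

/-- A cutoff function, equal to `1` near the origin. -/
lemma exists_cutoff : ∃ χ : Test, tsupport χ ⊆ Metric.closedBall 0 1 ∧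
    ∀ x ∈ Metric.ball (0 : Plane) (1 / 2), χ x = 1 := by
  let f : ContDiffBump (0 : Plane) := ⟨1 / 2, 1, by norm_num, by norm_num⟩
  refine ⟨⟨f, f.contDiff, f.hasCompactSupport, by simp⟩, f.tsupport_eq.subset, fun x hx => ?_⟩
  exact f.one_of_mem_closedBall (Metric.ball_subset_closedBall hx)

lemma apply_eq_of_eqOn_ball {R : Dist} (hR : Distribution.IsVanishingOn R {0}ᶜ) {φ ψ : Test}
    {ε : ℝ} (hε : 0 < ε) (h : EqOn φ ψ (Metric.ball 0 ε)) : R φ = R ψ := by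
  rw [← sub_eq_zero, ← map_sub]
  refine hR _ fun x hx hx0 => ?_
  rw [mem_singleton_iff] at hx0
  subst hx0
  refine notMem_tsupport_iff_eventuallyEq.2 ?_ hx
  filter_upwards [Metric.ball_mem_nhds (0 : Plane) hε] with y hy
  change φ y - ψ y = 0
  rw [h hy, sub_self]

/-- A distribution supported at the origin annihilates the test functions that vanish there to
sufficiently high order. -/
lemma exists_apply_eq_zero_of_isFlat {R : Dist} (hR : Distribution.IsVanishingOn R {0}ᶜ) :
    ∃ k, ∀ φ, IsFlat k φ → R φ = 0 := by
  obtain ⟨N, C, hC0, hC⟩ := exists_order R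
  obtain ⟨χ, hχs, hχ1⟩ := exists_cutoff
  refine ⟨N + 1, fun φ hφ => ?_⟩
  obtain ⟨B, hB0, hB⟩ := hφ.exists_bound
  choose a ha0 ha using exists_iteratedFDeriv_bound χ
  set A := ∑ i ∈ Finset.range (N + 1), a i with hA
  have hA0 : 0 ≤ A := Finset.sum_nonneg fun i _ => ha0 i
  have haA : ∀ i ≤ N, a i ≤ A := fun i hi =>
    Finset.single_le_sum (f := a) (fun i _ => ha0 i) (Finset.mem_range.2 (by omega))
  -- Replace `φ` by `χ(2 ^ n x) φ`, which does not change `R φ`. In the Leibniz formula `j`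
  -- derivatives on the cutoff cost `2 ^ (n j)`, while flatness of order `N + 1` makes the other
  -- factor at most `B * 2 ^ (-n (j + 1))` on the shrunken support. One factor `2 ^ (-n)` is left
  -- over; the binomial coefficients sum to at most `2 ^ N`.
  have key : ∀ n : ℕ, |R φ| ≤ (C * (2 ^ N * (A * B))) * (1 / 2) ^ n := by
    intro n
    set χn := halve^[n] χ with hχn
    have h2n : (1 : ℝ) ≤ 2 ^ n := one_le_pow₀ (by norm_num)
    have hsup : tsupport χn ⊆ {x | ‖x‖ ≤ (1 / 2) ^ n} := by
      refine closure_minimal (fun x hx => ?_) (isClosed_le continuous_norm continuous_const)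
      rw [Function.mem_support, hχn, halve_iterate_apply] at hx
      have := hχs (subset_tsupport _ hx)
      rw [mem_closedBall_zero_iff, norm_smul, norm_pow, Real.norm_ofNat] at this
      rw [mem_ofPred_eq, one_div, inv_pow, ← one_div, le_div_iff₀ (by positivity)]
      linarith
    have heq : R φ = R (mulTest χn φ) := by
      refine apply_eq_of_eqOn_ball hR (ε := (1 / 2) ^ (n + 1)) (by positivity) fun x hx => ?_
      change φ x = χn x * φ x
      rw [hχn, halve_iterate_apply, hχ1, one_mul]
      rw [mem_ball_zero_iff] at hx ⊢
      rw [norm_smul, norm_pow, Real.norm_ofNat]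
      calc (2 : ℝ) ^ n * ‖x‖ < 2 ^ n * (1 / 2) ^ (n + 1) := by gcongr
        _ = 1 / 2 := by rw [pow_succ, ← mul_assoc, ← mul_pow]; norm_num
    rw [heq, mul_assoc C]
    refine hC _ _ (by positivity) ?_ fun i hi x => ?_
    · refine (closure_mono (t := Function.support χn) fun x hx => ?_).trans (hsup.trans fun x hx => ?_)
      · exact fun h => hx (show χn x * φ x = 0 by rw [h, zero_mul])
      · rw [mem_closedBall_zero_iff]
        exact le_trans hx (pow_le_one₀ (by norm_num) (by norm_num))
    · have h1 := norm_iteratedFDeriv_mul_le (contDiff_nat χn i) (contDiff_nat φ i) x (n := i) le_rfl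
      refine h1.trans ?_
      have hterm : ∀ j ∈ Finset.range (i + 1), (i.choose j : ℝ) * ‖iteratedFDeriv ℝ j χn x‖ *
          ‖iteratedFDeriv ℝ (i - j) φ x‖ ≤ (i.choose j : ℝ) * (A * B * (1 / 2) ^ n) := by
        intro j hj
        rw [Finset.mem_range] at hj
        rw [mul_assoc]
        refine mul_le_mul_of_nonneg_left ?_ (by positivity)
        by_cases hx : x ∈ tsupport χn
        · have hxn : ‖x‖ ≤ (1 / 2) ^ n := hsup hx
          have h3 : ‖iteratedFDeriv ℝ j χn x‖ ≤ (2 ^ n) ^ j * A := by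
            rw [hχn, iteratedFDeriv_halve_iterate, norm_smul, norm_pow, norm_pow, Real.norm_ofNat]
            gcongr
            exact (ha j _).trans (haA j (by omega))
          have h4 : ‖iteratedFDeriv ℝ (i - j) φ x‖ ≤ B * (((1 / 2) ^ n) ^ j * (1 / 2) ^ n) := by
            refine (hB (i - j) (N - i + j + 1) (by omega) x).trans ?_
            gcongr
            calc ‖x‖ ^ (N - i + j + 1) ≤ ((1 / 2) ^ n) ^ (N - i + j + 1) := by gcongr
              _ ≤ ((1 / 2) ^ n) ^ (j + 1) := pow_le_pow_of_le_one (by positivity)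
                  (pow_le_one₀ (by norm_num) (by norm_num)) (by omega)
              _ = _ := pow_succ _ _
          calc _ ≤ ((2 ^ n) ^ j * A) * (B * (((1 / 2) ^ n) ^ j * (1 / 2) ^ n)) := by gcongr
            _ = A * B * (1 / 2) ^ n * ((2 ^ n * (1 / 2) ^ n) ^ j) := by rw [mul_pow]; ring
            _ = A * B * (1 / 2) ^ n := by rw [← mul_pow]; norm_num
        · have : iteratedFDeriv ℝ j χn x = 0 := by
            by_contra h
            exact hx (support_iteratedFDeriv_subset j h)
          rw [this, norm_zero, zero_mul]
          positivity
      refine (Finset.sum_le_sum hterm).trans ?_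
      rw [← Finset.sum_mul, ← Nat.cast_sum, Nat.sum_range_choose]
      push_cast
      rw [mul_assoc (2 ^ N : ℝ)]
      gcongr
      norm_num
  have hlim : Tendsto (fun n : ℕ => (C * (2 ^ N * (A * B))) * (1 / 2 : ℝ) ^ n) atTop (𝓝 0) := by
    simpa using (tendsto_pow_atTop_nhds_zero_of_lt_one (r := (1 / 2 : ℝ)) (by norm_num)
      (by norm_num)).const_mul (C * (2 ^ N * (A * B)))
  exact abs_nonpos_iff.1 (ge_of_tendsto' hlim key)

/-- A distribution supported at the origin whose rescalings tend to zero is zero. -/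
lemma eq_zero_of_isVanishingOn_punctured {R : Dist} (hR : Distribution.IsVanishingOn R {0}ᶜ)
    (hlim : ∀ φ, Tendsto (fun n : ℕ => R (halve^[n] φ)) atTop (𝓝 0)) : R = 0 := by
  obtain ⟨N, hN⟩ := exists_apply_eq_zero_of_isFlat hR
  -- Descending induction on the order of flatness, in place of the structure theorem for
  -- distributions supported at a point. If `R` kills flatness `k + 1`, then `R (halve ψ) = 2 ^ k *
  -- R ψ` for `ψ` flat of order `k`. As `2 ^ k ≥ 1`, even for `k = 0`, the iterates can tend to zero
  -- only if `R φ = 0`.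
  have key : ∀ j k, N ≤ k + j → ∀ φ, IsFlat k φ → R φ = 0 := by
    intro j
    induction j with
    | zero => exact fun k hk φ hφ => hN φ fun i hi => hφ i (by omega)
    | succ j ih =>
      intro k hk φ hφ
      have h1 : ∀ ψ, IsFlat k ψ → R (halve ψ) = 2 ^ k * R ψ := by
        intro ψ hψ
        have := ih (k + 1) (by omega) _ hψ.halve_sub
        rw [map_sub, map_smul, sub_eq_zero] at this
        simpa using this
      have h2 : ∀ n : ℕ, R (halve^[n] φ) = (2 ^ k) ^ n * R φ ∧ IsFlat k (halve^[n] φ) := by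
        intro n
        induction n with
        | zero => simpa using hφ
        | succ n ihn =>
          rw [Function.iterate_succ_apply', h1 _ ihn.2, ihn.1]
          exact ⟨by ring, ihn.2.halve⟩
      have h3 : ∀ n : ℕ, |R φ| ≤ |R (halve^[n] φ)| := by
        intro n
        have h1k : (1 : ℝ) ≤ (2 ^ k) ^ n := one_le_pow₀ (one_le_pow₀ (by norm_num))
        rw [(h2 n).1, abs_mul, abs_of_pos (zero_lt_one.trans_le h1k)]
        exact le_mul_of_one_le_left (abs_nonneg _) h1k
      have h4 := (hlim φ).abs
      rw [abs_zero] at h4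
      exact abs_nonpos_iff.1 (ge_of_tendsto' h4 h3)
  ext φ
  exact key N 0 (by omega) φ fun i hi => absurd hi (by omega)

/-- Dominated convergence: the iterates keep the same bound, and their supports stay in one ball and
shrink to the origin. -/
lemma tendsto_integral_mul_halve_iterate {t : Plane → ℝ} (ht : LocallyIntegrable t) (φ : Test) :
    Tendsto (fun n : ℕ => ∫ x, t x * halve^[n] φ x) atTop (𝓝 0) := by
  obtain ⟨M, hM⟩ := φ.continuous.bounded_above_of_compact_support φ.hasCompactSupport
  obtain ⟨ρ, hρ0, hρ⟩ := φ.hasCompactSupport.isBounded.subset_closedBall_lt 0 0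
  have hfar : ∀ y : Plane, ρ < ‖y‖ → φ y = 0 := fun y hy =>
    image_eq_zero_of_notMem_tsupport fun h => by
      have := hρ h
      rw [mem_closedBall_zero_iff] at this
      linarith
  have hz : (0 : ℝ) = ∫ _ : Plane, (0 : ℝ) := by simp
  rw [hz]
  refine tendsto_integral_of_dominated_convergence
    (fun x => (Metric.closedBall (0 : Plane) ρ).indicator (fun x => ‖t x‖ * M) x) (fun n => ?_) ?_
    (fun n => .of_forall fun x => ?_) ?_
  · exact (integrable_mul_test ht _).aestronglyMeasurable
  · exact IntegrableOn.integrable_indicator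
      (((ht.integrableOn_isCompact (isCompact_closedBall _ _)).norm).mul_const M)
      measurableSet_closedBall
  · rw [halve_iterate_apply]
    by_cases hx : x ∈ Metric.closedBall (0 : Plane) ρ
    · rw [indicator_of_mem hx, norm_mul]
      gcongr
      exact hM _
    · rw [indicator_of_notMem hx, hfar, mul_zero, norm_zero]
      rw [mem_closedBall_zero_iff, not_le] at hx
      rw [norm_smul, norm_pow, Real.norm_ofNat]
      exact hx.trans_le (le_mul_of_one_le_left (norm_nonneg _) (one_le_pow₀ (by norm_num)))
  · have h0 : ∀ᵐ x : Plane, x ≠ 0 := by simp [ae_iff]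
    filter_upwards [h0] with x hx
    refine tendsto_const_nhds.congr' ?_
    have h1 : Tendsto (fun n : ℕ => (2 : ℝ) ^ n * ‖x‖) atTop atTop :=
      (tendsto_pow_atTop_atTop_of_one_lt (by norm_num)).atTop_mul_const (norm_pos_iff.2 hx)
    filter_upwards [h1.eventually_gt_atTop ρ] with n hn
    rw [halve_iterate_apply, hfar, mul_zero]
    rwa [norm_smul, norm_pow, Real.norm_ofNat]

/-- A distribution of negative degree that is a locally integrable function away from the origin is
this function on the whole plane. -/
lemma apply_eq_integral {T : Dist} (hT : ∀ φ, Tendsto (fun n : ℕ => T (halve^[n] φ)) atTop (𝓝 0))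
    {t : Plane → ℝ} (ht : LocallyIntegrable t)
    (h : ∀ φ : Test, tsupport φ ⊆ {0}ᶜ → T φ = ∫ x, t x * φ x) (φ : Test) :
    T φ = ∫ x, t x * φ x := by
  have h0 : T - ofDensity t = 0 := by
    refine eq_zero_of_isVanishingOn_punctured (fun φ hφ => ?_) fun φ => ?_
    · change T φ - ofDensity t φ = 0
      rw [h φ hφ, ofDensity_apply ht, sub_self]
    · change Tendsto (fun n : ℕ => T (halve^[n] φ) - ofDensity t (halve^[n] φ)) atTop (𝓝 0)
      simp only [ofDensity_apply ht]
      simpa using (hT φ).sub (tendsto_integral_mul_halve_iterate ht φ)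
  rw [sub_eq_zero.1 h0, ofDensity_apply ht]

/-! ### The degree -/

lemma dilate_zero (l : ℝ) : dilate l 0 = 0 := by
  ext x
  simp [dilate_apply]

lemma halve_iterate_eq_dilate (n : ℕ) (φ : Test) :
    halve^[n] φ = (((1 / 2 : ℝ) ^ n) ^ 2) • dilate ((1 / 2) ^ n) φ := by
  ext x
  change _ = ((1 / 2 : ℝ) ^ n) ^ 2 * ((((1 / 2 : ℝ) ^ n) ^ 2)⁻¹ * φ (((1 / 2 : ℝ) ^ n)⁻¹ • x))
  rw [halve_iterate_apply, mul_inv_cancel_left₀ (by positivity)]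
  simp

section Degree

variable {ι : Type*} [Fintype ι] {T : ι → Dist}

/-- Only dyadic scales are needed later. Negative degree supplies an exponent `m < 2`, and
`halve^[n] φ` is the dilate at scale `l = 2 ^ (-n)` multiplied by `l ^ 2`, so the surplus `l ^ (2 -
m)` tends to zero. -/
lemma tendsto_halve_iterate_of_degree_neg (h : degree T < 0) (i : ι) (φ : Test) :
    Tendsto (fun n : ℕ => T i (halve^[n] φ)) atTop (𝓝 0) := by
  classical
  have h2 : sInf ((fun m : ℝ => (m : EReal)) '' {m : ℝ | ∀ ψ : ι → Test,
      Tendsto (fun l : ℝ => l ^ m * pairing T (fun i => dilate l (ψ i))) (𝓝[>] 0) (𝓝 0)}) < 2 := by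
    by_contra hcon
    rw [not_lt] at hcon
    have := EReal.sub_le_sub hcon (le_refl (2 : EReal))
    refine absurd h (not_lt.2 (le_trans ?_ this))
    change (0 : EReal) ≤ ((2 : ℝ) : EReal) - ((2 : ℝ) : EReal)
    rw [← EReal.coe_sub, sub_self, EReal.coe_zero]
  obtain ⟨_, ⟨m, hm, rfl⟩, hm2⟩ := sInf_lt_iff.1 h2
  have hm2' : m < 2 := EReal.coe_lt_coe_iff.1 hm2
  -- Testing with a single nonzero component isolates `T i`.
  have h3 := hm (Pi.single i φ)
  have hp : ∀ l : ℝ, pairing T (fun j => dilate l ((Pi.single i φ : ι → Test) j)) =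
      T i (dilate l φ) := by
    intro l
    rw [pairing, Finset.sum_eq_single i]
    · simp
    · intro j _ hj
      simp [hj, dilate_zero]
    · simp
  simp only [hp] at h3
  have h4 : Tendsto (fun l : ℝ => l ^ (2 - m) * (l ^ m * T i (dilate l φ))) (𝓝[>] 0) (𝓝 0) := by
    have h5 : Tendsto (fun l : ℝ => l ^ (2 - m)) (𝓝[>] 0) (𝓝 0) := by
      have := (Real.continuousAt_rpow_const 0 (2 - m) (.inr (by linarith))).tendsto
      rw [Real.zero_rpow (by linarith)] at this
      exact this.mono_left nhdsWithin_le_nhds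
    simpa using h5.mul h3
  have h6 : Tendsto (fun n : ℕ => (1 / 2 : ℝ) ^ n) atTop (𝓝[>] 0) :=
    tendsto_nhdsWithin_iff.2 ⟨tendsto_pow_atTop_nhds_zero_of_lt_one (by norm_num) (by norm_num),
      .of_forall fun n => by simp⟩
  refine (h4.comp h6).congr fun n => ?_
  have hpos : (0 : ℝ) < (1 / 2) ^ n := by positivity
  rw [Function.comp_apply, ← mul_assoc, ← Real.rpow_add hpos, halve_iterate_eq_dilate, map_smul]
  norm_num

lemma degree_neg_of_pairing_const
    (h : ∀ ψ : ι → Test, ∀ l : ℝ, 0 < l → pairing T (fun i => dilate l (ψ i)) = pairing T ψ) :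
    degree T < 0 := by
  have h1 : sInf ((fun m : ℝ => (m : EReal)) '' {m : ℝ | ∀ ψ : ι → Test,
      Tendsto (fun l : ℝ => l ^ m * pairing T (fun i => dilate l (ψ i))) (𝓝[>] 0) (𝓝 0)}) ≤ 1 := by
    -- Any exponent strictly between `0` and `2` would do.
    refine sInf_le ⟨1, fun ψ => ?_, by simp⟩
    have h2 : Tendsto (fun l : ℝ => l * pairing T ψ) (𝓝[>] 0) (𝓝 0) := by
      have : Tendsto (fun l : ℝ => l * pairing T ψ) (𝓝 0) (𝓝 (0 * pairing T ψ)) :=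
        tendsto_id.mul_const _
      rw [zero_mul] at this
      exact this.mono_left nhdsWithin_le_nhds
    refine h2.congr' ?_
    filter_upwards [self_mem_nhdsWithin] with l hl
    rw [h ψ l hl, Real.rpow_one]
  refine lt_of_le_of_lt (EReal.sub_le_sub h1 le_rfl) ?_
  change ((1 : ℝ) : EReal) - ((2 : ℝ) : EReal) < ((0 : ℝ) : EReal)
  rw [← EReal.coe_sub, EReal.coe_lt_coe_iff]
  norm_num

end Degree

/-! ### Developable tensor fields on the punctured plane -/

/-- A smooth field of symmetric, singular, non-zero and curl-free tensors on the punctured plane: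
locally the second fundamental form of a developable surface. -/
structure IsDevelopable (M : Plane → Matrix (Fin 2) (Fin 2) ℝ) : Prop where
  smooth : ∀ i j, ContDiffOn ℝ ∞ (fun x => M x i j) {0}ᶜ
  symm : ∀ x, x ≠ 0 → M x 1 0 = M x 0 1
  curl : ∀ x, x ≠ 0 → ∀ i, fderiv ℝ (fun y => M y i 1) x (e 0) = fderiv ℝ (fun y => M y i 0) x (e 1)
  det : ∀ x, x ≠ 0 → (M x).det = 0
  ne : ∀ x, x ≠ 0 → M x ≠ 0

/-- The components of the vector field `M v`, for a constant vector `v`. -/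
def row (M : Plane → Matrix (Fin 2) (Fin 2) ℝ) (v : Plane) (i : Fin 2) (x : Plane) : ℝ :=
  M x i 0 * v 0 + M x i 1 * v 1

/-- The cross product in the plane. -/
def cross (v x : Plane) : ℝ := v 0 * x 1 - v 1 * x 0

/-- Rotation by a right angle. -/
def rot (v : Plane) : Plane := !₂[-v 1, v 0]

@[simp] lemma rot_zero (v : Plane) : rot v 0 = -v 1 := rfl

@[simp] lemma rot_one (v : Plane) : rot v 1 = v 0 := rfl

@[simp] lemma e_apply (i j : Fin 2) : e i j = if j = i then 1 else 0 := by
  simp [e]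

lemma eq_sum_e (v : Plane) : v = v 0 • e 0 + v 1 • e 1 := by
  ext i
  fin_cases i <;> simp

lemma plane_ext {x y : Plane} (h0 : x 0 = y 0) (h1 : x 1 = y 1) : x = y := by
  ext i
  fin_cases i
  · exact h0
  · exact h1

lemma ne_zero_iff_coord {v : Plane} : v ≠ 0 ↔ v 0 ≠ 0 ∨ v 1 ≠ 0 := by
  rw [← not_iff_not]
  push Not
  exact ⟨fun h => by simp [h], fun h => plane_ext (by simpa using h.1) (by simpa using h.2)⟩

lemma sq_add_sq_pos {v : Plane} (hv : v ≠ 0) : 0 < v 0 ^ 2 + v 1 ^ 2 := by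
  rcases ne_zero_iff_coord.1 hv with h | h <;> positivity

lemma clm_apply_eq (L : Plane →L[ℝ] ℝ) (v : Plane) : L v = v 0 * L (e 0) + v 1 * L (e 1) := by
  conv_lhs => rw [eq_sum_e v]
  simp

lemma row_smul (M : Plane → Matrix (Fin 2) (Fin 2) ℝ) (c : ℝ) (v : Plane) (i : Fin 2) (x : Plane) :
    row M (c • v) i x = c * row M v i x := by
  simp [row]
  ring

lemma exists_smul_of_cross_eq_zero {v u : Plane} (hv : v ≠ 0) (h : cross v u = 0) :
    ∃ c : ℝ, u = c • v := by
  have h2 := sq_add_sq_pos hv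
  refine ⟨(v 0 * u 0 + v 1 * u 1) / (v 0 ^ 2 + v 1 ^ 2), plane_ext ?_ ?_⟩ <;>
  · simp only [PiLp.smul_apply, smul_eq_mul]
    rw [div_mul_eq_mul_div, eq_div_iff h2.ne']
    unfold cross at h
    first
    | linear_combination (-v 1) * h
    | linear_combination (v 0) * h

lemma cross_add_smul (v x u : Plane) (s : ℝ) : cross v (x + s • u) = cross v x + s * cross v u := by
  simp [cross]
  ring

lemma cross_self (v : Plane) : cross v v = 0 := by
  simp [cross]
  ring

lemma cross_rot (v : Plane) : cross v (rot v) = v 0 ^ 2 + v 1 ^ 2 := by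
  simp [cross]
  ring

lemma ne_zero_of_cross_ne_zero {v x : Plane} (h : cross v x ≠ 0) : x ≠ 0 := by
  rintro rfl
  simp [cross] at h

/-- Let `M` be the singular form with entries `a, b, c`, `τ = a + c` its trace, `M'` the form with
entries `A, B, C`, and `p = M v` for `v = (x, y)`. Since `M² = τ M`, the vector `w = v - p / τ` lies
in the kernel when `τ ≠ 0`; the linearised determinant equation `h` gives `M'(w, w) = 0`. Expanding
`M'(v, v)` in `w` and `p` leaves `τ² M'(v, v) = M'(2 τ v - p, p)`, which carries a factor `p`. -/
lemma quadratic_form_identity {a b c A B C : ℝ} (x y : ℝ) (hdet : a * c = b ^ 2)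
    (h : A * c + a * C = 2 * b * B) :
    (A * x ^ 2 + 2 * B * x * y + C * y ^ 2) * (a + c) ^ 2 =
      (A * (2 * (a + c) * x - (a * x + b * y)) + B * (2 * (a + c) * y - (b * x + c * y))) *
        (a * x + b * y) +
      (B * (2 * (a + c) * x - (a * x + b * y)) + C * (2 * (a + c) * y - (b * x + c * y))) *
        (b * x + c * y) := by
  linear_combination (c * x ^ 2 - 2 * b * x * y + a * y ^ 2) * h +
    (-A * y ^ 2 + 2 * B * x * y - C * x ^ 2) * hdet

/-! ### Kernels and rulings of a developable field -/

namespace IsDevelopable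

variable {M : Plane → Matrix (Fin 2) (Fin 2) ℝ}


lemma differentiableAt (hM : IsDevelopable M) {x : Plane} (hx : x ≠ 0) (i j : Fin 2) :
    DifferentiableAt ℝ (fun x => M x i j) x :=
  ((hM.smooth i j).contDiffAt (isOpen_punctured.mem_nhds hx)).differentiableAt (by simp)

lemma curl' (hM : IsDevelopable M) {x : Plane} (hx : x ≠ 0) (i j k : Fin 2) :
    fderiv ℝ (fun y => M y i j) x (e k) = fderiv ℝ (fun y => M y i k) x (e j) := by
  fin_cases j <;> fin_cases k
  · rfl
  · exact (hM.curl x hx i).symm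
  · exact hM.curl x hx i
  · rfl

lemma trace_ne_zero (hM : IsDevelopable M) {x : Plane} (hx : x ≠ 0) :
    M x 0 0 + M x 1 1 ≠ 0 := by
  intro h
  refine hM.ne x hx ?_
  have h1 := hM.det x hx
  have h2 := hM.symm x hx
  rw [Matrix.det_fin_two, h2] at h1
  have h3 : M x 0 0 ^ 2 + M x 0 1 ^ 2 = 0 := by linear_combination M x 0 0 * h - h1
  have h4 : M x 0 0 = 0 := by nlinarith [sq_nonneg (M x 0 0), sq_nonneg (M x 0 1)]
  have h5 : M x 0 1 = 0 := by nlinarith [sq_nonneg (M x 0 0), sq_nonneg (M x 0 1)]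
  have h6 : M x 1 1 = 0 := by linarith
  ext i j
  fin_cases i <;> fin_cases j
  · exact h4
  · exact h5
  · exact h2.trans h5
  · exact h6

lemma exists_ker (hM : IsDevelopable M) {x : Plane} (hx : x ≠ 0) :
    ∃ u : Plane, u ≠ 0 ∧ ∀ i, row M u i x = 0 := by
  have h1 := hM.det x hx
  have h2 := hM.symm x hx
  rw [Matrix.det_fin_two, h2] at h1
  by_cases h : M x 0 0 = 0 ∧ M x 0 1 = 0
  · refine ⟨e 0, ne_zero_iff_coord.2 (.inl (by simp)), fun i => ?_⟩
    fin_cases i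
    · simp [row, h.1]
    · simp [row, h2, h.2]
  · refine ⟨!₂[-M x 0 1, M x 0 0], ne_zero_iff_coord.2 ?_, fun i => ?_⟩
    · by_cases h0 : M x 0 0 = 0
      · exact .inl (neg_ne_zero.2 fun h1 => h ⟨h0, h1⟩)
      · exact .inr h0
    · fin_cases i
      · simp [row]
        ring
      · simp [row, h2]
        linarith

lemma eq_zero_of_ker (hM : IsDevelopable M) {x u v : Plane} (hu : ∀ i, row M u i x = 0)
    (hv : ∀ i, row M v i x = 0) (huv : cross v u ≠ 0) : x = 0 := by
  by_contra hx
  refine hM.ne x hx ?_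
  have h : ∀ i, M x i 0 = 0 ∧ M x i 1 = 0 := by
    intro i
    have h1 := hu i
    have h2 := hv i
    unfold row at h1 h2
    unfold cross at huv
    constructor
    · refine (mul_eq_zero.1 (?_ : (v 0 * u 1 - v 1 * u 0) * M x i 0 = 0)).resolve_left huv
      linear_combination u 1 * h2 - v 1 * h1
    · refine (mul_eq_zero.1 (?_ : (v 0 * u 1 - v 1 * u 0) * M x i 1 = 0)).resolve_left huv
      linear_combination v 0 * h1 - u 0 * h2
  ext i j
  fin_cases j
  · exact (h i).1
  · exact (h i).2

/-- The kernel of a developable tensor field is constant along the lines which it spans. -/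
lemma ker_of_segment (hM : IsDevelopable M) {x v : Plane} (hv : ∀ i, row M v i x = 0)
    (h0 : ∀ s ∈ Icc (0 : ℝ) 1, x + s • v ≠ 0) : ∀ i, row M v i (x + v) = 0 := by
  set γ : ℝ → Plane := fun s => x + s • v with hγ
  have hγc : Continuous γ := by fun_prop
  have hγd : ∀ s, HasDerivAt γ v s := fun s => by
    simpa [hγ] using ((hasDerivAt_id s).smul_const v).const_add x
  have hmaps : MapsTo γ (Icc 0 1) {0}ᶜ := fun s hs => h0 s hs
  have hMc : ∀ i j, ContinuousOn (fun s => M (γ s) i j) (Icc 0 1) := fun i j =>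
    (hM.smooth i j).continuousOn.comp hγc.continuousOn hmaps
  have hDc : ∀ i j k, ContinuousOn (fun s => fderiv ℝ (fun y => M y i j) (γ s) (e k)) (Icc 0 1) :=
    fun i j k => (contDiffOn_fderiv_apply isOpen_punctured (hM.smooth i j) _).continuousOn.comp
      hγc.continuousOn hmaps
  set d : Fin 2 → Fin 2 → Fin 2 → ℝ → ℝ :=
    fun i j k s => fderiv ℝ (fun y => M y i j) (γ s) (e k) with hd
  set p : Fin 2 → ℝ → ℝ := fun i s => row M v i (γ s) with hp
  have hpc : ∀ i, ContinuousOn (p i) (Icc 0 1) := fun i =>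
    ((hMc i 0).mul continuousOn_const).add ((hMc i 1).mul continuousOn_const)
  have hpd : ∀ i, ∀ s ∈ Icc (0 : ℝ) 1, HasDerivAt (p i)
      ((v 0 * d i 0 0 s + v 1 * d i 0 1 s) * v 0 + (v 0 * d i 1 0 s + v 1 * d i 1 1 s) * v 1) s := by
    intro i s hs
    have h1 : ∀ j, HasDerivAt (fun s => M (γ s) i j) (v 0 * d i j 0 s + v 1 * d i j 1 s) s := by
      intro j
      have := (hM.differentiableAt (h0 s hs) i j).hasFDerivAt.comp_hasDerivAt s (hγd s)
      rw [clm_apply_eq] at this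
      exact this
    exact ((h1 0).mul_const _).add ((h1 1).mul_const _)
  set τ : ℝ → ℝ := fun s => M (γ s) 0 0 + M (γ s) 1 1 with hτ
  have hτc : ContinuousOn τ (Icc 0 1) := (hMc 0 0).add (hMc 1 1)
  have hτ0 : ∀ s ∈ Icc (0 : ℝ) 1, τ s ^ 2 ≠ 0 := fun s hs =>
    pow_ne_zero 2 (hM.trace_ne_zero (h0 s hs))
  -- The vector `2 τ v - p` of `quadratic_form_identity`; it yields the coefficients `m` of a linear
  -- system for `p = M v`.
  set u : Fin 2 → ℝ → ℝ := fun i s => 2 * τ s * v i - p i s with hu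
  have huc : ∀ i, ContinuousOn (u i) (Icc 0 1) := fun i =>
    ((continuousOn_const.mul hτc).mul continuousOn_const).sub (hpc i)
  set m : Fin 2 → Fin 2 → ℝ → ℝ := fun i j s => (d i j 0 s * u 0 s + d i j 1 s * u 1 s) / τ s ^ 2
    with hm
  have hmc : ∀ i j, ContinuousOn (m i j) (Icc 0 1) := fun i j =>
    (((hDc i j 0).mul (huc 0)).add ((hDc i j 1).mul (huc 1))).div (hτc.pow 2) hτ0
  -- As `M` is curl-free and symmetric, the derivative of `p i` along `v` is the quadratic form `∂_i
  -- M (v, v)`, to which the identity applies. Hence `p' = m p`.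
  have hpm : ∀ i, ∀ s ∈ Icc (0 : ℝ) 1,
      (v 0 * d i 0 0 s + v 1 * d i 0 1 s) * v 0 + (v 0 * d i 1 0 s + v 1 * d i 1 1 s) * v 1 =
      m i 0 s * p 0 s + m i 1 s * p 1 s := by
    intro i s hs
    have hx := h0 s hs
    have hx' : γ s ∈ ({0}ᶜ : Set Plane) := hx
    have hdet : M (γ s) 0 0 * M (γ s) 1 1 = M (γ s) 0 1 ^ 2 := by
      have := hM.det _ hx
      rw [Matrix.det_fin_two, hM.symm _ hx] at this
      linear_combination this
    have hsd : ∀ k, d 1 0 k s = d 0 1 k s := by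
      intro k
      simp only [hd]
      have : (fun y => M y 1 0) =ᶠ[𝓝 (γ s)] (fun y => M y 0 1) :=
        Filter.eventually_of_mem (isOpen_punctured.mem_nhds hx') fun y hy => hM.symm y hy
      rw [this.fderiv_eq]
    have hcd : ∀ i, d i 0 1 s = d i 1 0 s := fun i => (hM.curl _ hx i).symm
    have hdd : ∀ k, d 0 0 k s * M (γ s) 1 1 + M (γ s) 0 0 * d 1 1 k s =
        2 * M (γ s) 0 1 * d 0 1 k s := by
      intro k
      have he : (fun y => M y 0 0 * M y 1 1) =ᶠ[𝓝 (γ s)] (fun y => M y 0 1 ^ 2) :=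
        Filter.eventually_of_mem (isOpen_punctured.mem_nhds hx') fun y hy => by
          have := hM.det _ hy
          rw [Matrix.det_fin_two, hM.symm _ hy] at this
          linear_combination this
      have h1 := he.fderiv_eq (𝕜 := ℝ)
      have h2 := DFunLike.congr_fun h1 (e k)
      rw [fderiv_fun_mul (hM.differentiableAt hx 0 0) (hM.differentiableAt hx 1 1),
        fderiv_fun_pow 2 (hM.differentiableAt hx 0 1)] at h2
      simp only [_root_.add_apply, _root_.smul_apply, smul_eq_mul] at h2
      simp only [hd]
      norm_num at h2
      linear_combination h2
    have e4 := hcd 0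
    have e5 : d 1 1 0 s = d 0 1 1 s := (hcd 1).symm.trans (hsd 1)
    have hp0 : p 0 s = M (γ s) 0 0 * v 0 + M (γ s) 0 1 * v 1 := rfl
    have hp1 : p 1 s = M (γ s) 0 1 * v 0 + M (γ s) 1 1 * v 1 := by
      rw [← hM.symm _ hx]
      rfl
    have hτs : τ s = M (γ s) 0 0 + M (γ s) 1 1 := rfl
    have f0 := hdd 0
    have f1 := hdd 1
    rw [e5] at f0
    rw [e4] at f1
    simp only [hm, hu]
    rw [div_mul_eq_mul_div, div_mul_eq_mul_div, ← add_div, eq_div_iff (hτ0 s hs), hp0, hp1, hτs]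
    revert i
    refine Fin.forall_fin_two.2 ⟨?_, ?_⟩
    · rw [e4]
      linear_combination quadratic_form_identity (v 0) (v 1) hdet f0
    · rw [hsd 0, hsd 1, e5]
      linear_combination quadratic_form_identity (v 0) (v 1) hdet f1
  -- Grönwall for `|p|²`, which vanishes at `s = 0` and satisfies `|E'| ≤ K E` because each `|p i *
  -- p j|` is at most `|p|²`.
  have hE : ∀ s ∈ Icc (0 : ℝ) 1, p 0 s ^ 2 + p 1 s ^ 2 = 0 := by
    obtain ⟨K, hK⟩ := isCompact_Icc.exists_bound_of_continuousOn
      (f := fun s => 2 * (|m 0 0 s| + |m 0 1 s| + |m 1 0 s| + |m 1 1 s|))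
      (continuousOn_const.mul ((((hmc 0 0).abs.add (hmc 0 1).abs).add (hmc 1 0).abs).add
        (hmc 1 1).abs))
    refine eq_zero_of_abs_deriv_le_mul_abs_self_of_eq_zero_right (K := K)
      (f' := fun s => 2 * p 0 s * (m 0 0 s * p 0 s + m 0 1 s * p 1 s) +
        2 * p 1 s * (m 1 0 s * p 0 s + m 1 1 s * p 1 s)) (((hpc 0).pow 2).add ((hpc 1).pow 2))
      (fun s hs => ?_) ?_ fun s hs => ?_
    · have hs' := Ico_subset_Icc_self hs
      have h1 := hpd 0 s hs'
      have h2 := hpd 1 s hs'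
      rw [hpm _ s hs'] at h1 h2
      have h3 := (h1.fun_pow 2).fun_add (h2.fun_pow 2)
      refine (h3.congr_deriv ?_).hasDerivWithinAt
      norm_num
    · simp [hp, hγ, hv]
    · have hs' := Ico_subset_Icc_self hs
      have h1 := hK s hs'
      rw [Real.norm_eq_abs, abs_of_nonneg (by positivity)] at h1
      rw [Real.norm_eq_abs, Real.norm_eq_abs, abs_of_nonneg (a := p 0 s ^ 2 + p 1 s ^ 2)
        (by positivity)]
      refine le_trans ?_ (mul_le_mul_of_nonneg_right h1 (by positivity))
      have h2 : |p 0 s * p 1 s| ≤ p 0 s ^ 2 + p 1 s ^ 2 := by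
        rw [abs_le]
        constructor <;> nlinarith [sq_nonneg (p 0 s + p 1 s), sq_nonneg (p 0 s - p 1 s)]
      calc _ = |2 * (m 0 0 s * p 0 s ^ 2 + m 0 1 s * (p 0 s * p 1 s) + m 1 0 s * (p 0 s * p 1 s) +
            m 1 1 s * p 1 s ^ 2)| := by congr 1; ring
        _ = 2 * |m 0 0 s * p 0 s ^ 2 + m 0 1 s * (p 0 s * p 1 s) + m 1 0 s * (p 0 s * p 1 s) +
            m 1 1 s * p 1 s ^ 2| := by rw [abs_mul, abs_of_pos (by norm_num : (0 : ℝ) < 2)]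
        _ ≤ 2 * (|m 0 0 s * p 0 s ^ 2| + |m 0 1 s * (p 0 s * p 1 s)| +
            |m 1 0 s * (p 0 s * p 1 s)| + |m 1 1 s * p 1 s ^ 2|) := by
          gcongr
          exact (abs_add_le _ _).trans (add_le_add ((abs_add_le _ _).trans
            (add_le_add (abs_add_le _ _) le_rfl)) le_rfl)
        _ ≤ 2 * (|m 0 0 s| * (p 0 s ^ 2 + p 1 s ^ 2) + |m 0 1 s| * (p 0 s ^ 2 + p 1 s ^ 2) +
            |m 1 0 s| * (p 0 s ^ 2 + p 1 s ^ 2) + |m 1 1 s| * (p 0 s ^ 2 + p 1 s ^ 2)) := by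
          simp only [abs_mul (m _ _ s)]
          rw [abs_of_nonneg (sq_nonneg (p 0 s)), abs_of_nonneg (sq_nonneg (p 1 s))]
          gcongr
          · exact le_add_of_nonneg_right (sq_nonneg _)
          · exact le_add_of_nonneg_left (sq_nonneg _)
        _ = _ := by ring
  intro i
  have h1 := hE 1 (by simp)
  have h2 : p 0 1 = 0 := by nlinarith [sq_nonneg (p 0 1), sq_nonneg (p 1 1)]
  have h3 : p 1 1 = 0 := by nlinarith [sq_nonneg (p 0 1), sq_nonneg (p 1 1)]
  simp only [hp, hγ, one_smul] at h2 h3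
  fin_cases i
  · exact h2
  · exact h3

end IsDevelopable

lemma hasFDerivAt_coord (k : Fin 2) (x : Plane) :
    HasFDerivAt (fun y : Plane => y k) (EuclideanSpace.proj k : Plane →L[ℝ] ℝ) x :=
  (EuclideanSpace.proj k : Plane →L[ℝ] ℝ).hasFDerivAt

/-! ### Global arrangement of the rulings -/

namespace IsDevelopable

variable {M : Plane → Matrix (Fin 2) (Fin 2) ℝ}

lemma ker_smul {x v : Plane} (hv : ∀ i, row M v i x = 0) (c : ℝ) : ∀ i, row M (c • v) i x = 0 :=
  fun i => by rw [row_smul, hv i, mul_zero]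

/-- The kernel direction at a point cannot point to a point with a different kernel, unless the
origin lies in between. -/
lemma not_ker_of_segment (hM : IsDevelopable M) {x u v : Plane} (hu : ∀ i, row M u i x = 0)
    (huv : cross v u ≠ 0) {c : ℝ} (h0 : ∀ s ∈ Icc (0 : ℝ) 1, x + s • c • u ≠ 0)
    (hv : ∀ i, row M v i (x + c • u) = 0) : False := by
  have h1 := hM.ker_of_segment (ker_smul hu c) h0
  by_cases hc : c = 0
  · subst hc
    have h2 := h0 0 (by simp)
    simp only [zero_smul, add_zero] at hv h2
    exact h2 (hM.eq_zero_of_ker hu hv huv)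
  · have h2 := h0 1 (by simp)
    rw [one_smul] at h2
    refine h2 (hM.eq_zero_of_ker h1 hv ?_)
    have : cross v (c • u) = c * cross v u := by
      simp [cross]
      ring
    rw [this]
    exact mul_ne_zero hc huv

/-- `cross v` measures the side of the line `ℝ v`. The factor in front of `u` is chosen so that the
segment ends on the level `d`. -/
lemma segment_combination {v x u : Plane} (huv : cross v u ≠ 0) (d s : ℝ) :
    cross v (x + s • ((d - cross v x) / cross v u) • u) = (1 - s) * cross v x + s * d := by
  rw [smul_smul, cross_add_smul]
  field_simp
  ring

/-- The line through `x₀` parallel to `v` misses the origin, so `v` spans the kernel all along it. A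
ruling from `x` not parallel to `v` would reach this line without leaving the half-plane, hence
without meeting the origin, and two distinct kernels would meet there. -/
lemma ker_half_plane (hM : IsDevelopable M) {x₀ v : Plane} (hv0 : v ≠ 0)
    (hv : ∀ i, row M v i x₀ = 0) (h0 : cross v x₀ ≠ 0) {x : Plane} (hx : x ≠ 0)
    (hx' : 0 ≤ cross v x₀ * cross v x) : ∀ i, row M v i x = 0 := by
  have hline : ∀ y, cross v y = cross v x₀ → ∀ i, row M v i y = 0 := by
    intro y hy
    obtain ⟨c, hc⟩ := exists_smul_of_cross_eq_zero (u := y - x₀) hv0 (by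
      simp only [cross, PiLp.sub_apply] at hy ⊢
      linear_combination hy)
    obtain rfl : y = x₀ + c • v := by rw [← hc]; abel
    by_cases hc0 : c = 0
    · simpa [hc0] using hv
    have h1 := hM.ker_of_segment (ker_smul hv c) (x := x₀) fun s _ => by
      refine ne_zero_of_cross_ne_zero (v := v) ?_
      rw [smul_smul, cross_add_smul, cross_self, mul_zero, add_zero]
      exact h0
    have h2 := ker_smul h1 c⁻¹
    rwa [smul_smul, inv_mul_cancel₀ hc0, one_smul] at h2
  obtain ⟨u, hu0, hu⟩ := hM.exists_ker hx
  by_cases huv : cross v u = 0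
  · obtain ⟨c, rfl⟩ := exists_smul_of_cross_eq_zero hv0 huv
    have hc : c ≠ 0 := fun h => hu0 (by simp [h])
    have h2 := ker_smul hu c⁻¹
    rwa [smul_smul, inv_mul_cancel₀ hc, one_smul] at h2
  · exfalso
    have h1 := segment_combination (x := x) huv (cross v x₀)
    refine hM.not_ker_of_segment hu huv (c := (cross v x₀ - cross v x) / cross v u) ?_ ?_
    · intro s hs
      -- The point `x` may lie on the boundary line `ℝ v` through the origin; for `s > 0` the
      -- segment is strictly inside the half-plane.
      rcases hs.1.eq_or_lt with rfl | hs0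
      · simpa using hx
      · refine ne_zero_of_cross_ne_zero (v := v) fun h => ?_
        rw [h1] at h
        have h3 : 0 < cross v x₀ ^ 2 := by positivity
        have h4 : (1 - s) * (cross v x₀ * cross v x) + s * cross v x₀ ^ 2 = 0 := by
          linear_combination cross v x₀ * h
        have h5 : 0 ≤ (1 - s) * (cross v x₀ * cross v x) :=
          mul_nonneg (by linarith [hs.2]) hx'
        have h6 : 0 < s * cross v x₀ ^ 2 := mul_pos hs0 h3
        linarith
    · refine hline _ ?_
      have := h1 1
      rw [one_smul] at this
      rw [this]
      ring

/-- The ruling through `x`, not being parallel to `v`, meets the line `ℝ v`. Every point of this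
line but the origin has kernel `v` by `ker_half_plane`, so the ruling must hit the origin and is
radial. -/
lemma ker_self_of_opposite (hM : IsDevelopable M) {x₀ v : Plane} (hv0 : v ≠ 0)
    (hv : ∀ i, row M v i x₀ = 0) (h0 : cross v x₀ ≠ 0) {x : Plane} (hx : cross v x ≠ 0)
    (hxv : ¬ ∀ i, row M v i x = 0) : ∀ i, row M x i x = 0 := by
  have hx0 := ne_zero_of_cross_ne_zero hx
  obtain ⟨u, hu0, hu⟩ := hM.exists_ker hx0
  by_cases huv : cross v u = 0
  · obtain ⟨c, rfl⟩ := exists_smul_of_cross_eq_zero hv0 huv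
    have hc : c ≠ 0 := fun h => hu0 (by simp [h])
    have h2 := ker_smul hu c⁻¹
    rw [smul_smul, inv_mul_cancel₀ hc, one_smul] at h2
    exact absurd h2 hxv
  · have h1 := segment_combination (x := x) huv 0
    set c := (0 - cross v x) / cross v u with hc
    by_cases hy : x + c • u = 0
    · have : x = (-c) • u := by rw [neg_smul]; exact eq_neg_of_add_eq_zero_left hy
      have h2 := ker_smul hu (-c)
      rwa [← this] at h2
    · exfalso
      refine hM.not_ker_of_segment hu huv (c := c) ?_ ?_
      · intro s hs
        rcases hs.2.eq_or_lt with rfl | hs1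
        · rwa [one_smul]
        · refine ne_zero_of_cross_ne_zero (v := v) ?_
          rw [h1, mul_zero, add_zero]
          exact mul_ne_zero (by linarith) hx
      · refine hM.ker_half_plane hv0 hv h0 hy ?_
        have := h1 1
        rw [one_smul] at this
        rw [this]
        simp

/-- The derivative along a vector field in the kernel, when this field is constant. -/
lemma fderiv_of_ker (hM : IsDevelopable M) {x v : Plane} (hx : x ≠ 0)
    (h : ∀ᶠ y in 𝓝 x, ∀ i, row M v i y = 0) (i j : Fin 2) :
    fderiv ℝ (fun y => M y i j) x v = 0 := by
  -- The curl condition moves the derivative: `∂_v M_ij = ∂_j (M v)_i = 0`.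
  rw [clm_apply_eq, hM.curl' hx i j 0, hM.curl' hx i j 1]
  have h1 : (fun y => M y i 0 * v 0 + M y i 1 * v 1) =ᶠ[𝓝 x] fun _ => (0 : ℝ) :=
    h.mono fun y hy => hy i
  have h2 := DFunLike.congr_fun (h1.fderiv_eq (𝕜 := ℝ)) (e j)
  rw [fderiv_fun_add ((hM.differentiableAt hx i 0).mul_const _)
    ((hM.differentiableAt hx i 1).mul_const _), fderiv_mul_const (hM.differentiableAt hx i 0),
    fderiv_mul_const (hM.differentiableAt hx i 1)] at h2
  simpa using h2

/-- Where the position vector is in the kernel, the field is homogeneous of degree `-1`. -/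
lemma fderiv_of_ker_self (hM : IsDevelopable M) {x : Plane} (hx : x ≠ 0)
    (h : ∀ᶠ y in 𝓝 x, ∀ i, row M y i y = 0) (i j : Fin 2) :
    fderiv ℝ (fun y => M y i j) x x = -M x i j := by
  rw [clm_apply_eq, hM.curl' hx i j 0, hM.curl' hx i j 1]
  -- As for a constant direction, but here `∂_j` also falls on the position vector and contributes
  -- `M_ij`.
  have h1 : (fun y => M y i 0 * y 0 + M y i 1 * y 1) =ᶠ[𝓝 x] fun _ => (0 : ℝ) :=
    h.mono fun y hy => hy i
  have h2 := DFunLike.congr_fun (h1.fderiv_eq (𝕜 := ℝ)) (e j)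
  have d0 := hM.differentiableAt hx i 0
  have d1 := hM.differentiableAt hx i 1
  have c0 := hasFDerivAt_coord 0 x
  have c1 := hasFDerivAt_coord 1 x
  rw [((d0.hasFDerivAt.fun_mul c0).fun_add (d1.hasFDerivAt.fun_mul c1)).fderiv] at h2
  fin_cases j <;> simp at h2 ⊢ <;> linarith

/-- The rulings of a developable field on the punctured plane are either all radial or all
parallel. -/
lemma radial_or_parallel (hM : IsDevelopable M) :
    (∀ x, x ≠ 0 → ∀ i, row M x i x = 0) ∨ ∃ v : Plane, v ≠ 0 ∧ ∀ x, x ≠ 0 → ∀ i, row M v i x = 0 := by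
  by_contra hcon
  push Not at hcon
  obtain ⟨⟨x₀, hx₀, i₀, hi₀⟩, hpar⟩ := hcon
  obtain ⟨v, hv0, hv⟩ := hM.exists_ker hx₀
  have h0 : cross v x₀ ≠ 0 := by
    intro h
    obtain ⟨c, hc⟩ := exists_smul_of_cross_eq_zero hv0 h
    refine hi₀ ?_
    have := ker_smul hv c i₀
    rwa [← hc] at this
  have hup : ∀ x, x ≠ 0 → 0 ≤ cross v x₀ * cross v x → ∀ i, row M v i x = 0 := fun x =>
    hM.ker_half_plane hv0 hv h0
  -- A single point of the opposite half-plane with kernel `v` would, by `ker_half_plane` based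
  -- there, make all rulings parallel.
  have hlow : ∀ x, cross v x₀ * cross v x < 0 → ¬ ∀ i, row M v i x = 0 := by
    intro x hx hxv
    obtain ⟨y, hy, j, hj⟩ := hpar v hv0
    refine hj (hM.ker_half_plane hv0 hxv (fun h => by simp [h] at hx) hy ?_ j)
    by_contra hneg
    rw [not_le] at hneg
    refine hj (hup y hy ?_ j)
    by_contra hneg'
    rw [not_le] at hneg'
    have h1 := mul_pos_of_neg_of_neg hx hneg
    have h2 : cross v x₀ * cross v x * (cross v x * cross v y) =
      cross v x ^ 2 * (cross v x₀ * cross v y) := by ring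
    rw [h2] at h1
    nlinarith [sq_nonneg (cross v x)]
  have hlow' : ∀ x, cross v x₀ * cross v x < 0 → ∀ i, row M x i x = 0 := fun x hx =>
    hM.ker_self_of_opposite hv0 hv h0 (fun h => by simp [h] at hx) (hlow x hx)
  have hcc : Continuous (cross v) := by
    unfold cross
    fun_prop
  -- The contradiction is found at `v` itself, a boundary point of the two half-planes. The curve
  -- `γ` crosses the boundary there at `t = 0`, and `t = ± cross v x₀ * s` with `s > 0` selects the
  -- side.
  refine hM.ne v hv0 ?_
  ext i j
  have hsm := contDiffOn_fderiv_apply isOpen_punctured (hM.smooth i j)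
  set γ : ℝ → Plane := fun t => v + t • rot v with hγ
  have hγc : Continuous γ := by fun_prop
  have hγ0 : γ 0 = v := by simp [hγ]
  have hcγ : ∀ t, cross v (γ t) = t * (v 0 ^ 2 + v 1 ^ 2) := fun t => by
    simp only [hγ]
    rw [cross_add_smul, cross_self, cross_rot, zero_add]
  have hγne : ∀ᶠ t in 𝓝 (0 : ℝ), γ t ≠ 0 :=
    hγc.continuousAt.eventually_ne (by rwa [hγ0])
  have hpos := sq_add_sq_pos hv0
  have hsq : 0 < cross v x₀ ^ 2 := by positivity
  have hD : ContinuousAt (fderiv ℝ fun y => M y i j) v :=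
    ((hM.smooth i j).fderiv_of_isOpen isOpen_punctured (m := ∞) (by simp)).continuousOn.continuousAt
      (isOpen_punctured.mem_nhds hv0)
  have hMc : ContinuousAt (fun y => M y i j) v := (hM.differentiableAt hv0 i j).continuousAt
  have hγt : Tendsto γ (𝓝 0) (𝓝 v) := by
    have := hγc.tendsto 0
    rwa [hγ0] at this
  have happ : Continuous fun q : (Plane →L[ℝ] ℝ) × Plane => q.1 q.2 :=
    isBoundedBilinearMap_apply.continuous
  have hF : Tendsto (fun t => fderiv ℝ (fun y => M y i j) (γ t) v) (𝓝 0)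
      (𝓝 (fderiv ℝ (fun y => M y i j) v v)) :=
    (happ.tendsto _).comp ((hD.tendsto.comp hγt).prodMk_nhds tendsto_const_nhds)
  have hG : Tendsto (fun t => fderiv ℝ (fun y => M y i j) (γ t) (γ t) + M (γ t) i j) (𝓝 0)
      (𝓝 (fderiv ℝ (fun y => M y i j) v v + M v i j)) :=
    ((happ.tendsto _).comp ((hD.tendsto.comp hγt).prodMk_nhds hγt)).add (hMc.tendsto.comp hγt)
  have hscale : ∀ c : ℝ, Tendsto (fun s : ℝ => c * s) (𝓝[>] 0) (𝓝 0) := fun c => by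
    have : Tendsto (fun s : ℝ => c * s) (𝓝 0) (𝓝 (c * 0)) := tendsto_id.const_mul c
    rw [mul_zero] at this
    exact this.mono_left nhdsWithin_le_nhds
  have h1 : fderiv ℝ (fun y => M y i j) v v = 0 := by
    refine tendsto_nhds_unique (hF.comp (hscale (cross v x₀)))
      (tendsto_const_nhds.congr' ?_)
    filter_upwards [self_mem_nhdsWithin, (hscale (cross v x₀)).eventually hγne] with s hs hne
    have hs' : (0 : ℝ) < s := hs
    refine (hM.fderiv_of_ker hne ?_ i j).symm
    have hp : 0 < cross v x₀ * cross v (γ (cross v x₀ * s)) := by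
      rw [hcγ]
      have : cross v x₀ * (cross v x₀ * s * (v 0 ^ 2 + v 1 ^ 2)) =
        cross v x₀ ^ 2 * (s * (v 0 ^ 2 + v 1 ^ 2)) := by ring
      rw [this]
      positivity
    have he := (continuous_const.mul hcc).continuousAt.eventually_const_lt
      (f := fun y => cross v x₀ * cross v y) hp
    filter_upwards [he, isOpen_punctured.mem_nhds hne] with y hy hy0
    exact hup y hy0 hy.le
  have h2 : fderiv ℝ (fun y => M y i j) v v + M v i j = 0 := by
    refine tendsto_nhds_unique (hG.comp (hscale (-cross v x₀)))
      (tendsto_const_nhds.congr' ?_)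
    filter_upwards [self_mem_nhdsWithin, (hscale (-cross v x₀)).eventually hγne] with s hs hne
    have hs' : (0 : ℝ) < s := hs
    have hp : cross v x₀ * cross v (γ (-cross v x₀ * s)) < 0 := by
      rw [hcγ]
      have : cross v x₀ * (-cross v x₀ * s * (v 0 ^ 2 + v 1 ^ 2)) =
        -(cross v x₀ ^ 2 * (s * (v 0 ^ 2 + v 1 ^ 2))) := by ring
      rw [this, neg_lt_zero]
      positivity
    have he := (continuous_const.mul hcc).continuousAt.eventually_lt_const
      (f := fun y => cross v x₀ * cross v y) hp
    rw [Function.comp_apply, hM.fderiv_of_ker_self hne (he.mono fun y hy => hlow' y hy) i j,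
      neg_add_cancel]
  rw [h1, zero_add] at h2
  exact h2

/-- If the rulings are parallel, the field is smooth across the origin, up to a null set. -/
lemma exists_smooth_of_parallel (hM : IsDevelopable M) {v : Plane} (hv0 : v ≠ 0)
    (hv : ∀ x, x ≠ 0 → ∀ i, row M v i x = 0) :
    ∃ t : Plane → Matrix (Fin 2) (Fin 2) ℝ, (∀ i j, ContDiff ℝ ∞ fun x => t x i j) ∧
      ∀ᵐ x, t x = M x := by
  have hpos := sq_add_sq_pos hv0
  -- Projection along `v` onto the line through the point `v` orthogonal to it. This line avoids the
  -- origin, so `M ∘ P` is smooth everywhere; it equals `M` off the null line `ℝ v`, because `M` is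
  -- constant along `v`.
  set P : Plane → Plane := fun x => v + (cross v x / (v 0 ^ 2 + v 1 ^ 2)) • rot v with hP
  have hcs : ContDiff ℝ ∞ (cross v) := by
    unfold cross
    fun_prop
  have hPs : ContDiff ℝ ∞ P := contDiff_const.add ((hcs.div_const _).smul contDiff_const)
  have hP0 : ∀ x, P x ≠ 0 := by
    intro x h
    have h1 : v 0 * P x 0 + v 1 * P x 1 = v 0 ^ 2 + v 1 ^ 2 := by
      simp [hP]
      ring
    rw [h] at h1
    simp at h1
    linarith
  refine ⟨fun x => M (P x), fun i j => ?_, ?_⟩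
  · rw [← contDiffOn_univ]
    exact (hM.smooth i j).comp hPs.contDiffOn fun x _ => hP0 x
  · have hnull : ∀ᵐ x : Plane, cross v x ≠ 0 := by
      let L : Plane →ₗ[ℝ] ℝ :=
        { toFun := cross v
          map_add' := fun x y => by simp [cross]; ring
          map_smul' := fun c x => by simp [cross]; ring }
      have hL : LinearMap.ker L ≠ ⊤ := by
        intro h
        have h1 : rot v ∈ LinearMap.ker L := h ▸ Submodule.mem_top
        have h2 : cross v (rot v) = 0 := h1
        rw [cross_rot] at h2
        linarith
      have := Measure.addHaar_submodule (volume : Measure Plane) (LinearMap.ker L) hL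
      rw [ae_iff]
      refine measure_mono_null (fun x hx => ?_) this
      simpa [L] using hx
    filter_upwards [hnull] with x hx
    ext i j
    obtain ⟨c, hc⟩ := exists_smul_of_cross_eq_zero (u := P x - x) hv0 (by
      have : cross v (P x) = cross v x := by
        simp only [hP]
        rw [cross_add_smul, cross_self, cross_rot, zero_add, div_mul_cancel₀ _ hpos.ne']
      simp only [cross, PiLp.sub_apply] at this ⊢
      linear_combination this)
    have hPx : P x = x + c • v := by rw [← hc]; abel
    have hne : ∀ s : ℝ, x + s • v ≠ 0 := fun s => by
      refine ne_zero_of_cross_ne_zero (v := v) ?_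
      rwa [cross_add_smul, cross_self, mul_zero, add_zero]
    have hd : ∀ s : ℝ, HasDerivAt (fun s : ℝ => M (x + s • v) i j) 0 s := by
      intro s
      have h1 : HasDerivAt (fun s : ℝ => x + s • v) v s := by
        simpa using ((hasDerivAt_id s).smul_const v).const_add x
      have h2 := (hM.differentiableAt (hne s) i j).hasFDerivAt.comp_hasDerivAt s h1
      rw [hM.fderiv_of_ker (hne s) (Filter.eventually_of_mem
        (isOpen_punctured.mem_nhds (hne s)) hv) i j] at h2
      exact h2
    have h3 := is_const_of_deriv_eq_zero (fun s => (hd s).differentiableAt)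
      (fun s => (hd s).deriv) c 0
    simp only [zero_smul, add_zero] at h3
    rw [hPx, h3]

/-- If the rulings are radial, the field is homogeneous of degree `-1`. -/
lemma smul_of_radial (hM : IsDevelopable M) (h : ∀ x, x ≠ 0 → ∀ i, row M x i x = 0) {x : Plane}
    (hx : x ≠ 0) {r : ℝ} (hr : 0 < r) (i j : Fin 2) : r * M (r • x) i j = M x i j := by
  have hd : ∀ s ∈ Ioi (0 : ℝ), HasDerivAt (fun s : ℝ => s * M (s • x) i j) 0 s := by
    intro s hs
    have hsx : s • x ≠ 0 := smul_ne_zero (ne_of_gt hs) hx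
    have h1 : HasDerivAt (fun s : ℝ => s • x) x s := by
      simpa using (hasDerivAt_id s).smul_const x
    have h2 := (hasDerivAt_id s).mul
      ((hM.differentiableAt hsx i j).hasFDerivAt.comp_hasDerivAt s h1)
    have h3 := hM.fderiv_of_ker_self hsx (Filter.eventually_of_mem
        (isOpen_punctured.mem_nhds hsx) h) i j
    rw [map_smul, smul_eq_mul] at h3
    -- Euler's relation `∂_x M = -M` makes the derivative of `s M(s x)` vanish.
    refine h2.congr_deriv ?_
    simp only [Function.comp_apply, id, one_mul]
    linarith
  have h4 := isOpen_Ioi.is_const_of_deriv_eq_zero isPreconnected_Ioi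
    (fun s hs => (hd s hs).differentiableAt.differentiableWithinAt)
    (fun s hs => (hd s hs).deriv) (mem_Ioi.2 hr) (mem_Ioi.2 one_pos)
  simpa using h4

end IsDevelopable

/-! ### Functions of the polar angle -/

/-- The plane as the complex line. -/
def toComplex : Plane →L[ℝ] ℂ :=
  (EuclideanSpace.proj 0 : Plane →L[ℝ] ℝ).smulRight (1 : ℂ) +
    (EuclideanSpace.proj 1 : Plane →L[ℝ] ℝ).smulRight Complex.I

lemma toComplex_apply (x : Plane) : toComplex x = ⟨x 0, x 1⟩ := by
  apply Complex.ext <;> simp [toComplex]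

lemma angle_eq_arg (x : Plane) : angle x = Complex.arg (toComplex x) := by
  rw [toComplex_apply, angle]

lemma norm_toComplex (x : Plane) : ‖toComplex x‖ = ‖x‖ := by
  rw [toComplex_apply, Complex.norm_eq_sqrt_sq_add_sq, EuclideanSpace.norm_eq]
  simp [Fin.sum_univ_two]

lemma toComplex_ne_zero {x : Plane} (hx : x ≠ 0) : toComplex x ≠ 0 := by
  rw [← norm_ne_zero_iff, norm_toComplex]
  exact norm_ne_zero_iff.2 hx

lemma coord_zero_eq (x : Plane) : x 0 = ‖x‖ * Real.cos (angle x) := by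
  rw [← norm_toComplex, angle_eq_arg, Complex.norm_mul_cos_arg, toComplex_apply]

lemma coord_one_eq (x : Plane) : x 1 = ‖x‖ * Real.sin (angle x) := by
  rw [← norm_toComplex, angle_eq_arg, Complex.norm_mul_sin_arg, toComplex_apply]

lemma angle_smul {l : ℝ} (hl : 0 < l) (x : Plane) : angle (l • x) = angle x := by
  rw [angle_eq_arg, angle_eq_arg, map_smul, Complex.real_smul, Complex.arg_real_mul _ hl]

lemma measurable_angle : Measurable angle := by
  have : angle = fun x => Complex.arg (toComplex x) := funext angle_eq_arg
  rw [this]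
  exact Complex.measurable_arg.comp toComplex.continuous.measurable

lemma periodic_congr {g : ℝ → ℝ} (hg : Function.Periodic g (2 * Real.pi)) {a b : ℝ}
    (h : (a : Real.Angle) = b) : g a = g b := by
  obtain ⟨k, hk⟩ := Real.Angle.angle_eq_iff_two_pi_dvd_sub.1 h
  have h1 : a = b + k * (2 * Real.pi) := by linarith
  rw [h1]
  exact hg.int_mul k b

lemma IsSmoothPeriodic.exists_bound {g : ℝ → ℝ} (hg : IsSmoothPeriodic g) :
    ∃ C, 0 ≤ C ∧ ∀ θ, |g θ| ≤ C := by
  obtain ⟨C, hC⟩ := isCompact_Icc.exists_bound_of_continuousOn (f := g)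
    (s := Icc 0 (2 * Real.pi)) hg.1.continuous.continuousOn
  refine ⟨C, (norm_nonneg _).trans (hC 0 (by simp [Real.pi_nonneg])), fun θ => ?_⟩
  obtain ⟨y, hy, hxy⟩ := hg.2.exists_mem_Ico₀ Real.two_pi_pos θ
  rw [hxy]
  exact hC y (Ico_subset_Icc_self hy)

lemma IsSmoothPeriodic.mul {g h : ℝ → ℝ} (hg : IsSmoothPeriodic g) (hh : IsSmoothPeriodic h) :
    IsSmoothPeriodic fun θ => g θ * h θ := ⟨hg.1.mul hh.1, hg.2.mul hh.2⟩

lemma IsSmoothPeriodic.add {g h : ℝ → ℝ} (hg : IsSmoothPeriodic g) (hh : IsSmoothPeriodic h) :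
    IsSmoothPeriodic fun θ => g θ + h θ := ⟨hg.1.add hh.1, hg.2.add hh.2⟩

lemma IsSmoothPeriodic.deriv {g : ℝ → ℝ} (hg : IsSmoothPeriodic g) :
    IsSmoothPeriodic (deriv g) := by
  refine ⟨hg.1.deriv' , fun θ => ?_⟩
  have h : (fun θ => g (θ + 2 * Real.pi)) = g := funext hg.2
  rw [← deriv_comp_add_const, h]

lemma isSmoothPeriodic_cos : IsSmoothPeriodic Real.cos := ⟨Real.contDiff_cos, Real.cos_periodic⟩

lemma isSmoothPeriodic_sin : IsSmoothPeriodic Real.sin := ⟨Real.contDiff_sin, Real.sin_periodic⟩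

/-- The radial unit vector at polar angle `θ`. -/
def eR (θ : ℝ) : Fin 2 → ℝ := ![Real.cos θ, Real.sin θ]

lemma isSmoothPeriodic_eR (i : Fin 2) : IsSmoothPeriodic fun θ => eR θ i := by
  fin_cases i
  · exact isSmoothPeriodic_cos
  · exact isSmoothPeriodic_sin

lemma isSmoothPeriodic_eTheta (i : Fin 2) : IsSmoothPeriodic fun θ => eTheta θ i := by
  fin_cases i
  · exact ⟨Real.contDiff_sin.neg, fun θ => by simp [eTheta]⟩
  · exact isSmoothPeriodic_cos

lemma hasDerivAt_eR (i : Fin 2) (θ : ℝ) : HasDerivAt (fun θ => eR θ i) (eTheta θ i) θ := by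
  fin_cases i
  · exact Real.hasDerivAt_cos θ
  · exact Real.hasDerivAt_sin θ

lemma hasDerivAt_eTheta (i : Fin 2) (θ : ℝ) : HasDerivAt (fun θ => eTheta θ i) (-eR θ i) θ := by
  fin_cases i
  · exact (Real.hasDerivAt_sin θ).neg
  · exact Real.hasDerivAt_cos θ

section Angle

variable {g : ℝ → ℝ} (hg : IsSmoothPeriodic g)
include hg

/-- A local representation of a function of the angle through the complex logarithm. -/
lemma comp_angle_eq {x₀ x : Plane} (h₀ : x₀ ≠ 0) (hx : x ≠ 0) : g (angle x) =
    g ((Complex.log (toComplex x / toComplex x₀)).im + angle x₀) := by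
  refine periodic_congr hg.2 ?_
  rw [Complex.log_im, Real.Angle.coe_add,
    Complex.arg_div_coe_angle (toComplex_ne_zero hx) (toComplex_ne_zero h₀), angle_eq_arg,
    angle_eq_arg, sub_add_cancel]

/-- The function `angle` jumps across the negative axis. Near `x₀` the logarithm of the ratio to
`x₀` stays near `log 1`, and it recovers the angle up to a multiple of `2π`, which a periodic
function does not see. -/
lemma contDiffOn_comp_angle : ContDiffOn ℝ ∞ (fun x => g (angle x)) {0}ᶜ := by
  intro x₀ h₀
  refine ContDiffAt.contDiffWithinAt ?_
  have he : (fun x => g (angle x)) =ᶠ[𝓝 x₀]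
      fun x => g ((Complex.log (toComplex x / toComplex x₀)).im + angle x₀) :=
    Filter.eventually_of_mem (isOpen_punctured.mem_nhds h₀) fun x hx => comp_angle_eq hg h₀ hx
  refine ContDiffAt.congr_of_eventuallyEq ?_ he
  have h1 : toComplex x₀ / toComplex x₀ = 1 := div_self (toComplex_ne_zero h₀)
  have hlog : ContDiffAt ℝ ∞ Complex.log (toComplex x₀ / toComplex x₀) := by
    rw [h1]
    exact (Complex.contDiffAt_log (by simp)).restrict_scalars ℝ
  have h2 : ContDiffAt ℝ ∞ (fun x => Complex.log (toComplex x / toComplex x₀)) x₀ :=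
    hlog.comp x₀ (toComplex.contDiff.contDiffAt.div_const _)
  have h3 : ContDiffAt ℝ ∞ (fun x => (Complex.log (toComplex x / toComplex x₀)).im) x₀ :=
    Complex.imCLM.contDiff.contDiffAt.comp x₀ h2
  exact hg.1.contDiffAt.comp x₀ (h3.add contDiffAt_const)

lemma fderiv_comp_angle {x : Plane} (hx : x ≠ 0) (i : Fin 2) :
    fderiv ℝ (fun x => g (angle x)) x (e i) = deriv g (angle x) * (eTheta (angle x) i / ‖x‖) := by
  have he : (fun y => g (angle y)) =ᶠ[𝓝 x]
      fun y => g ((Complex.log (toComplex y / toComplex x)).im + angle x) :=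
    Filter.eventually_of_mem (isOpen_punctured.mem_nhds hx) fun y hy => comp_angle_eq hg hx hy
  rw [he.fderiv_eq]
  have h1 : toComplex x / toComplex x = 1 := div_self (toComplex_ne_zero hx)
  have hlog : HasFDerivAt Complex.log
      ((ContinuousLinearMap.toSpanSingleton ℂ (1 : ℂ)).restrictScalars ℝ)
      (toComplex x / toComplex x) := by
    rw [h1]
    have := (Complex.hasDerivAt_log Complex.one_mem_slitPlane).hasFDerivAt.restrictScalars ℝ
    simpa using this
  have hdiv : HasFDerivAt (fun y => toComplex y / toComplex x)
      ((ContinuousLinearMap.mul ℝ ℂ (toComplex x)⁻¹).comp toComplex) x := by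
    have : (fun y => toComplex y / toComplex x) =
        fun y => ((ContinuousLinearMap.mul ℝ ℂ (toComplex x)⁻¹).comp toComplex) y := by
      funext y
      simp [div_eq_inv_mul]
    rw [this]
    exact ContinuousLinearMap.hasFDerivAt _
  have h2 := (Complex.imCLM.hasFDerivAt.comp x (hlog.comp x hdiv)).add_const (angle x)
  have hz : (Complex.log (toComplex x / toComplex x)).im + angle x = angle x := by simp [h1]
  have hgd : HasDerivAt g (deriv g (angle x))
      ((Complex.log (toComplex x / toComplex x)).im + angle x) := by
    rw [hz]
    exact (hg.1.differentiable (by simp) _).hasDerivAt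
  have h3 := hgd.comp_hasFDerivAt x h2
  have h4 : fderiv ℝ (fun y => g ((Complex.log (toComplex y / toComplex x)).im + angle x)) x = _ :=
    h3.fderiv
  rw [h4]
  have hr : ‖x‖ ≠ 0 := norm_ne_zero_iff.2 hx
  have hcalc : ((toComplex x)⁻¹ * toComplex (e i)).im = eTheta (angle x) i / ‖x‖ := by
    have hns : Complex.normSq (toComplex x) = ‖x‖ ^ 2 := by
      rw [Complex.normSq_eq_norm_sq, norm_toComplex]
    rw [Complex.mul_im, Complex.inv_re, Complex.inv_im, hns, toComplex_apply, toComplex_apply]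
    simp only
    rw [coord_zero_eq x, coord_one_eq x]
    fin_cases i <;> simp [eTheta] <;> field_simp
  rw [← hcalc]
  simp

end Angle

/-! ### Conical fields -/

/-- The function `r g(θ)`. -/
def cone (g : ℝ → ℝ) (x : Plane) : ℝ := ‖x‖ * g (angle x)

/-- The components of `g e_r + g' e_θ`, the gradient of `r g(θ)`. -/
def coneGrad (g : ℝ → ℝ) (i : Fin 2) (θ : ℝ) : ℝ := g θ * eR θ i + deriv g θ * eTheta θ i

/-- The components of `(f(θ)/r) e_θ ⊗ e_θ`. -/
def conicalField (f : ℝ → ℝ) (i j : Fin 2) (x : Plane) : ℝ :=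
  f (angle x) / ‖x‖ * (eTheta (angle x) i * eTheta (angle x) j)

section Cone

variable {g : ℝ → ℝ} (hg : IsSmoothPeriodic g)

/-- In this form only coordinates and functions of the angle have to be differentiated, not the
norm. -/
lemma cone_eq (g : ℝ → ℝ) (x : Plane) :
    cone g x = x 0 * (g (angle x) * Real.cos (angle x)) + x 1 * (g (angle x) * Real.sin (angle x)) := by
  rw [cone, coord_zero_eq x, coord_one_eq x]
  linear_combination (-‖x‖ * g (angle x)) * Real.sin_sq_add_cos_sq (angle x)

include hg

lemma isSmoothPeriodic_coneGrad (i : Fin 2) : IsSmoothPeriodic (coneGrad g i) :=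
  (hg.mul (isSmoothPeriodic_eR i)).add (hg.deriv.mul (isSmoothPeriodic_eTheta i))

/-- The terms in `g'` and `e_R` cancel, since `e_R' = e_θ` and `e_θ' = -e_R`. -/
lemma deriv_coneGrad (i : Fin 2) (θ : ℝ) :
    deriv (coneGrad g i) θ = (g θ + iteratedDeriv 2 g θ) * eTheta θ i := by
  have h1 : HasDerivAt g (deriv g θ) θ := (hg.1.differentiable (by simp) _).hasDerivAt
  have h2 : HasDerivAt (deriv g) (deriv (deriv g) θ) θ :=
    (hg.deriv.1.differentiable (by simp) _).hasDerivAt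
  have h3 := (h1.fun_mul (hasDerivAt_eR i θ)).fun_add (h2.fun_mul (hasDerivAt_eTheta i θ))
  have h4 : deriv (coneGrad g i) θ = _ := h3.deriv
  rw [h4, iteratedDeriv_succ, iteratedDeriv_one]
  ring

lemma contDiffOn_cone : ContDiffOn ℝ ∞ (cone g) {0}ᶜ := by
  have h : cone g = fun x => x 0 * (g (angle x) * Real.cos (angle x)) +
      x 1 * (g (angle x) * Real.sin (angle x)) := funext (cone_eq g)
  rw [h]
  have hc : ∀ k : Fin 2, ContDiffOn ℝ ∞ (fun x : Plane => x k) {0}ᶜ := fun k =>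
    (EuclideanSpace.proj k : Plane →L[ℝ] ℝ).contDiff.contDiffOn
  exact ((hc 0).mul (contDiffOn_comp_angle (hg.mul isSmoothPeriodic_cos))).add
    ((hc 1).mul (contDiffOn_comp_angle (hg.mul isSmoothPeriodic_sin)))

lemma fderiv_cone {x : Plane} (hx : x ≠ 0) (i : Fin 2) :
    fderiv ℝ (cone g) x (e i) = coneGrad g i (angle x) := by
  have h : cone g = fun x => x 0 * (g (angle x) * Real.cos (angle x)) +
      x 1 * (g (angle x) * Real.sin (angle x)) := funext (cone_eq g)
  have hd : ∀ {h : ℝ → ℝ}, IsSmoothPeriodic h → DifferentiableAt ℝ (fun x => h (angle x)) x :=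
    fun hh => ((contDiffOn_comp_angle hh).contDiffAt
      (isOpen_punctured.mem_nhds hx)).differentiableAt (by simp)
  have hgc := hg.mul isSmoothPeriodic_cos
  have hgs := hg.mul isSmoothPeriodic_sin
  have h1 := ((hasFDerivAt_coord 0 x).fun_mul (hd hgc).hasFDerivAt).fun_add
    ((hasFDerivAt_coord 1 x).fun_mul (hd hgs).hasFDerivAt)
  have hgd : HasDerivAt g (deriv g (angle x)) (angle x) :=
    (hg.1.differentiable (by simp) _).hasDerivAt
  have e1 : deriv (fun θ => g θ * Real.cos θ) (angle x) = _ :=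
    (hgd.fun_mul (Real.hasDerivAt_cos _)).deriv
  have e2 : deriv (fun θ => g θ * Real.sin θ) (angle x) = _ :=
    (hgd.fun_mul (Real.hasDerivAt_sin _)).deriv
  rw [h, h1.fderiv]
  simp only [_root_.add_apply, _root_.smul_apply, smul_eq_mul]
  rw [fderiv_comp_angle hgc hx, fderiv_comp_angle hgs hx, e1, e2, coord_zero_eq x, coord_one_eq x]
  have hr : ‖x‖ ≠ 0 := norm_ne_zero_iff.2 hx
  have hsc := Real.sin_sq_add_cos_sq (angle x)
  fin_cases i <;> simp [coneGrad, eR, eTheta] <;> field_simp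
  · linear_combination (-deriv g (angle x) * Real.sin (angle x)) * hsc
  · linear_combination (deriv g (angle x) * Real.cos (angle x)) * hsc

lemma fderiv_fderiv_cone {x : Plane} (hx : x ≠ 0) (i j : Fin 2) :
    fderiv ℝ (fun y => fderiv ℝ (cone g) y (e i)) x (e j) =
      conicalField (fun θ => g θ + iteratedDeriv 2 g θ) i j x := by
  have he : (fun y => fderiv ℝ (cone g) y (e i)) =ᶠ[𝓝 x] fun y => coneGrad g i (angle y) :=
    Filter.eventually_of_mem (isOpen_punctured.mem_nhds hx) fun y hy => fderiv_cone hg hy i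
  rw [he.fderiv_eq, fderiv_comp_angle (isSmoothPeriodic_coneGrad hg i) hx, deriv_coneGrad hg,
    conicalField]
  ring

lemma cone_gradDyad {x : Plane} (hx : x ≠ 0) (i j : Fin 2) :
    gradDyad (cone g) x i j = coneGrad g i (angle x) * coneGrad g j (angle x) := by
  rw [← fderiv_cone hg hx, ← fderiv_cone hg hx]
  rfl

-- The bound says `|t| ≤ C r ^ (k - 1)` away from the origin, and even `1 / r` is integrable near
-- the origin in dimension two. Multiplying by the norm keeps the hypothesis free of division at the
-- origin.
omit hg in
lemma locallyIntegrable_of_bound {t : Plane → ℝ} (ht : Measurable t) {C : ℝ} {k : ℕ}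
    (h : ∀ x, |t x| * ‖x‖ ≤ C * ‖x‖ ^ k) : LocallyIntegrable t := by
  refine locallyIntegrable_of_norm_le_rpow (C := C) (α := 1 - k) (by simp) ?_ ?_
    ht.aestronglyMeasurable
  · simp
    have : (0 : ℝ) ≤ k := Nat.cast_nonneg k
    linarith
  · have h0 : ∀ᵐ x : Plane, x ≠ 0 := by simp [ae_iff]
    filter_upwards [h0] with x hx
    have hr : 0 < ‖x‖ := norm_pos_iff.2 hx
    rw [neg_sub, Real.rpow_sub hr, Real.rpow_one, Real.rpow_natCast, ← mul_div_assoc,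
      le_div_iff₀ hr, Real.norm_eq_abs]
    exact h x

lemma locallyIntegrable_cone : LocallyIntegrable (cone g) := by
  obtain ⟨C, -, hC⟩ := hg.exists_bound
  refine locallyIntegrable_of_bound (C := C) (k := 2)
    (measurable_norm.mul (hg.1.continuous.measurable.comp measurable_angle)) fun x => ?_
  rw [cone, abs_mul, abs_norm]
  have := mul_le_mul_of_nonneg_right (hC (angle x)) (sq_nonneg ‖x‖)
  linarith

lemma locallyIntegrable_comp_angle : LocallyIntegrable fun x => g (angle x) := by
  obtain ⟨C, -, hC⟩ := hg.exists_bound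
  refine locallyIntegrable_of_bound (C := C) (k := 1)
    (hg.1.continuous.measurable.comp measurable_angle) fun x => ?_
  have := mul_le_mul_of_nonneg_right (hC (angle x)) (norm_nonneg x)
  linarith

lemma locallyIntegrable_conicalField (i j : Fin 2) : LocallyIntegrable (conicalField g i j) := by
  have hh := hg.mul ((isSmoothPeriodic_eTheta i).mul (isSmoothPeriodic_eTheta j))
  obtain ⟨C, hC0, hC⟩ := hh.exists_bound
  have heq : conicalField g i j =
      fun x => g (angle x) * (eTheta (angle x) i * eTheta (angle x) j) / ‖x‖ := by
    funext x
    rw [conicalField]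
    ring
  rw [heq]
  refine locallyIntegrable_of_bound (C := C) (k := 0)
    ((hh.1.continuous.measurable.comp measurable_angle).div measurable_norm) fun x => ?_
  rw [abs_div, abs_norm, pow_zero, mul_one]
  rcases eq_or_ne ‖x‖ 0 with h | h
  · simpa [h] using hC0
  · rw [div_mul_cancel₀ _ h]
    exact hC _

end Cone

/-! ### Homogeneity -/

lemma lineDeriv_dilate (l : ℝ) (v : Plane) (φ : Test) :
    ∂_{v} (dilate l φ) = l⁻¹ • dilate l (∂_{v} φ) := by
  ext x
  change (∂_{v} (dilate l φ)) x = l⁻¹ * ((l ^ 2)⁻¹ * (∂_{v} φ) (l⁻¹ • x))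
  rw [lineDeriv_test_apply, lineDeriv_test_apply]
  have h1 : HasFDerivAt (fun y : Plane => l⁻¹ • y) (l⁻¹ • ContinuousLinearMap.id ℝ Plane) x :=
    (hasFDerivAt_id x).const_smul l⁻¹
  have h2 := ((test_differentiable φ (l⁻¹ • x)).hasFDerivAt.comp x h1).const_mul ((l ^ 2)⁻¹)
  have h3 : fderiv ℝ (dilate l φ) x = _ := h2.fderiv
  rw [h3]
  simp
  ring

lemma integral_mul_dilate {h : Plane → ℝ} {l c : ℝ} (hl : 0 < l) (hh : ∀ x, h (l • x) = c * h x)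
    (φ : Test) : ∫ x, h x * dilate l φ x = c * ∫ x, h x * φ x := by
  have h1 := Measure.integral_comp_smul (volume : Measure Plane)
    (fun x => h x * dilate l φ x) l
  have h2 : ∀ x, h (l • x) * dilate l φ (l • x) = (l ^ 2)⁻¹ * (c * (h x * φ x)) := by
    intro x
    rw [hh, dilate_apply, smul_smul, inv_mul_cancel₀ hl.ne', one_smul]
    ring
  simp only [h2] at h1
  rw [integral_const_mul, integral_const_mul] at h1
  have h3 : Module.finrank ℝ Plane = 2 := by simp
  rw [h3, abs_of_pos (by positivity), smul_eq_mul] at h1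
  exact (mul_left_cancel₀ (by positivity) h1).symm

/-! ### The distribution with density `r g(θ)` -/

section ConicalPotential

variable {g : ℝ → ℝ} (hg : IsSmoothPeriodic g) {W : Dist}
  (hW : ∀ φ : Test, W φ = ∫ x : Plane, ‖x‖ * g (angle x) * φ x)

include hW

lemma apply_dilate_of_cone {l : ℝ} (hl : 0 < l) (φ : Test) : W (dilate l φ) = l * W φ := by
  rw [hW, hW]
  refine integral_mul_dilate (h := cone g) hl (fun x => ?_) φ
  rw [cone, cone, angle_smul hl, norm_smul, Real.norm_of_nonneg hl.le, mul_assoc]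

lemma grad_apply_dilate {l : ℝ} (hl : 0 < l) (φ : Test) (i : Fin 2) :
    grad W i (dilate l φ) = grad W i φ := by
  simp only [grad]
  rw [lineDeriv_dist_apply, lineDeriv_dist_apply, lineDeriv_dilate, map_smul,
    apply_dilate_of_cone hW hl, smul_eq_mul, inv_mul_cancel_left₀ hl.ne']

lemma hess_halve (φ : Test) (i j : Fin 2) : hess W i j (halve φ) = 1 / 2 * hess W i j φ := by
  simp only [hess]
  rw [lineDeriv_dist_apply, lineDeriv_dist_apply, halve]
  have h : ∂_{e j} ((1 / 4 : ℝ) • dilate (1 / 2) φ) =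
      (1 / 2 : ℝ) • dilate (1 / 2) (∂_{e j} φ) := by
    rw [LineDeriv.lineDerivOp_smul, lineDeriv_dilate, smul_smul]
    norm_num
  rw [h, map_smul, grad_apply_dilate hW (by norm_num), smul_eq_mul]
  ring

include hg

lemma hasSmoothDensityOn_cone : HasSmoothDensityOn W {0}ᶜ (cone g) :=
  ⟨contDiffOn_cone hg, fun φ _ => hW φ⟩

/-- The formula is a computation off the origin. Each halving of the test function halves `hess W`,
so the iterates tend to zero and no part concentrated at the origin can occur. -/
lemma hess_apply_eq_integral (i j : Fin 2) (φ : Test) :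
    hess W i j φ = ∫ x, conicalField (fun θ => g θ + iteratedDeriv 2 g θ) i j x * φ x := by
  have hf : IsSmoothPeriodic fun θ => g θ + iteratedDeriv 2 g θ := by
    refine hg.add ?_
    have : iteratedDeriv 2 g = deriv (deriv g) := by rw [iteratedDeriv_succ, iteratedDeriv_one]
    rw [this]
    exact hg.deriv.deriv
  refine apply_eq_integral (fun φ => ?_) (locallyIntegrable_conicalField hf i j) ?_ φ
  · have h : ∀ n : ℕ, hess W i j (halve^[n] φ) = (1 / 2) ^ n * hess W i j φ := by
      intro n
      induction n with
      | zero => simp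
      | succ n ih => rw [Function.iterate_succ_apply', hess_halve hW, ih, pow_succ']; ring
    simp only [h]
    simpa using (tendsto_pow_atTop_nhds_zero_of_lt_one (r := (1 / 2 : ℝ)) (by norm_num)
      (by norm_num)).mul_const (hess W i j φ)
  · have h := ((hasSmoothDensityOn_cone hg hW).lineDeriv isOpen_punctured (e i)).lineDeriv
      isOpen_punctured (e j)
    exact (h.congr fun x hx => (fderiv_fderiv_cone hg hx i j).symm).2

/-- `B = W` serves, and `P` has the bounded density `∇w ⊗ ∇w`. Both `∇W` and `P` are invariant under
dilation, whence the negative degrees. -/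
lemma exists_isDet : ∃ D, IsDet (hess W) D := by
  set P : TensorDist := fun i j => ofDensity fun x => coneGrad g i (angle x) * coneGrad g j (angle x)
    with hP
  have hsp : ∀ i j, IsSmoothPeriodic fun θ => coneGrad g i θ * coneGrad g j θ := fun i j =>
    (isSmoothPeriodic_coneGrad hg i).mul (isSmoothPeriodic_coneGrad hg j)
  have hPφ : ∀ i j φ, P i j φ = ∫ x, coneGrad g i (angle x) * coneGrad g j (angle x) * φ x :=
    fun i j φ => ofDensity_apply (locallyIntegrable_comp_angle (hsp i j)) φ
  refine ⟨_, W, cone g, P, locallyIntegrable_cone hg, hasSmoothDensityOn_cone hg hW, rfl, ?_, ?_, ?_,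
    rfl⟩
  · refine degree_neg_of_pairing_const fun ψ l hl => ?_
    simp only [pairing, grad_apply_dilate hW hl]
  · intro i j
    exact HasSmoothDensityOn.congr ⟨contDiffOn_comp_angle (hsp i j), fun φ _ => hPφ i j φ⟩
      fun x hx => cone_gradDyad hg hx i j
  · refine degree_neg_of_pairing_const fun ψ l hl => ?_
    simp only [pairing]
    refine Finset.sum_congr rfl fun p _ => ?_
    rw [hPφ, hPφ, integral_mul_dilate (c := 1) hl (fun x => ?_), one_mul]
    rw [angle_smul hl, one_mul]

end ConicalPotential

/-! ### The angular equation `g + g'' = f` -/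

/-- The integrand is the derivative of the periodic function `coneGrad g i`. -/
lemma integral_eTheta_eq_zero {g : ℝ → ℝ} (hg : IsSmoothPeriodic g) (i : Fin 2) :
    ∫ θ in (0 : ℝ)..(2 * Real.pi), (g θ + iteratedDeriv 2 g θ) * eTheta θ i = 0 := by
  have h1 : ∀ θ, HasDerivAt (coneGrad g i) ((g θ + iteratedDeriv 2 g θ) * eTheta θ i) θ := by
    intro θ
    rw [← deriv_coneGrad hg]
    exact ((isSmoothPeriodic_coneGrad hg i).1.differentiable (by simp) θ).hasDerivAt
  have hc : Continuous fun θ => (g θ + iteratedDeriv 2 g θ) * eTheta θ i := by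
    have : (fun θ => (g θ + iteratedDeriv 2 g θ) * eTheta θ i) = deriv (coneGrad g i) :=
      funext fun θ => (deriv_coneGrad hg i θ).symm
    rw [this]
    exact (isSmoothPeriodic_coneGrad hg i).deriv.1.continuous
  rw [intervalIntegral.integral_eq_sub_of_hasDerivAt (fun θ _ => h1 θ) (hc.intervalIntegrable _ _),
    sub_eq_zero]
  simpa using (isSmoothPeriodic_coneGrad hg i).2 0

lemma contDiff_primitive {h : ℝ → ℝ} (hh : ContDiff ℝ ∞ h) :
    ContDiff ℝ ∞ fun θ => ∫ t in (0 : ℝ)..θ, h t := by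
  have hd : ∀ θ, HasDerivAt (fun θ => ∫ t in (0 : ℝ)..θ, h t) (h θ) θ := fun θ =>
    (hh.continuous.integral_hasStrictDerivAt 0 θ).hasDerivAt
  rw [contDiff_infty_iff_deriv]
  refine ⟨fun θ => (hd θ).differentiableAt, ?_⟩
  have : deriv (fun θ => ∫ t in (0 : ℝ)..θ, h t) = h := funext fun θ => (hd θ).deriv
  rwa [this]

lemma isSmoothPeriodic_primitive {h : ℝ → ℝ} (hh : IsSmoothPeriodic h)
    (h0 : ∫ t in (0 : ℝ)..(2 * Real.pi), h t = 0) :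
    IsSmoothPeriodic fun θ => ∫ t in (0 : ℝ)..θ, h t := by
  refine ⟨contDiff_primitive hh.1, fun θ => ?_⟩
  have hi : ∀ a b, IntervalIntegrable h volume a b := fun a b => hh.1.continuous.intervalIntegrable a b
  simp only
  rw [← intervalIntegral.integral_add_adjacent_intervals (hi 0 θ) (hi θ _),
    hh.2.intervalIntegral_add_eq θ 0, zero_add, h0, add_zero]

/-- The equation `g + g'' = f` has a periodic solution if `f` is orthogonal to sine and cosine. -/
lemma exists_potential {f : ℝ → ℝ} (hf : IsSmoothPeriodic f)
    (h : ∀ i, ∫ θ in (0 : ℝ)..(2 * Real.pi), f θ * eTheta θ i = 0) :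
    ∃ g, IsSmoothPeriodic g ∧ ∀ θ, g θ + iteratedDeriv 2 g θ = f θ := by
  -- Variation of constants: `q` is to be the gradient `g e_R + g' e_θ`, so `q' = f e_θ` and `g = q
  -- · e_R`. The orthogonality condition is exactly the periodicity of `q`. Since `q' · e_R = 0`, it
  -- follows that `g' = q · e_θ` and `g'' = f - g`.
  set q : Fin 2 → ℝ → ℝ := fun i θ => ∫ t in (0 : ℝ)..θ, f t * eTheta t i with hq
  have hfe : ∀ i, IsSmoothPeriodic fun θ => f θ * eTheta θ i := fun i =>
    hf.mul (isSmoothPeriodic_eTheta i)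
  have hqs : ∀ i, IsSmoothPeriodic (q i) := fun i => isSmoothPeriodic_primitive (hfe i) (h i)
  have hqd : ∀ i θ, HasDerivAt (q i) (f θ * eTheta θ i) θ := fun i θ =>
    ((hfe i).1.continuous.integral_hasStrictDerivAt 0 θ).hasDerivAt
  set g : ℝ → ℝ := fun θ => q 0 θ * eR θ 0 + q 1 θ * eR θ 1 with hg
  have hgs : IsSmoothPeriodic g :=
    ((hqs 0).mul (isSmoothPeriodic_eR 0)).add ((hqs 1).mul (isSmoothPeriodic_eR 1))
  have hd1 : deriv g = fun θ => q 0 θ * eTheta θ 0 + q 1 θ * eTheta θ 1 := by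
    funext θ
    have := (((hqd 0 θ).fun_mul (hasDerivAt_eR 0 θ)).fun_add
      ((hqd 1 θ).fun_mul (hasDerivAt_eR 1 θ))).deriv
    rw [hg, this]
    simp [eR, eTheta]
    ring
  refine ⟨g, hgs, fun θ => ?_⟩
  have hd2 := (((hqd 0 θ).fun_mul (hasDerivAt_eTheta 0 θ)).fun_add
    ((hqd 1 θ).fun_mul (hasDerivAt_eTheta 1 θ))).deriv
  rw [iteratedDeriv_succ, iteratedDeriv_one, hd1, hd2, hg]
  simp [eR, eTheta]
  linear_combination f θ * Real.sin_sq_add_cos_sq θ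

/-! ### The two conical forms -/

lemma tensorPairing_single (T : TensorDist) (i j : Fin 2) (φ : Test) :
    tensorPairing T (Matrix.single i j φ) = T i j φ := by
  rw [tensorPairing, pairing, Finset.sum_eq_single (i, j)]
  · simp
  · rintro ⟨k, l⟩ - hkl
    have : Matrix.single i j φ k l = 0 := by
      refine Matrix.single_apply_of_ne _ _ _ _ _ ?_
      rintro ⟨rfl, rfl⟩
      exact hkl rfl
    simp [this]
  · simp

lemma hasConicalForm_iff {T : TensorDist} {f : ℝ → ℝ} (hf : IsSmoothPeriodic f) :
    HasConicalForm T f ↔ (∀ i j φ, T i j φ = ∫ x, conicalField f i j x * φ x) ∧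
      ∀ i, ∫ θ in (0 : ℝ)..(2 * Real.pi), f θ * eTheta θ i = 0 := by
  refine and_congr_left fun _ => ⟨fun h i j φ => ?_, fun h ψ => ?_⟩
  · rw [← tensorPairing_single, h]
    refine integral_congr_ae (.of_forall fun x => ?_)
    simp only
    rw [Finset.sum_eq_single i, Finset.sum_eq_single j]
    · simp [conicalField]
    · intro l _ hl
      simp [Matrix.single_apply_of_col_ne _ _ hl.symm]
    · simp
    · intro k _ hk
      simp [Matrix.single_apply_of_row_ne hk.symm]
    · simp
  · have hi : ∀ i j, Integrable fun x => conicalField f i j x * ψ i j x := fun i j =>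
      integrable_mul_test (locallyIntegrable_conicalField hf i j) _
    rw [tensorPairing, pairing, Fintype.sum_prod_type]
    simp only [h]
    change _ = ∫ x, ∑ i, ∑ j, conicalField f i j x * ψ i j x
    rw [integral_finsetSum _ fun i _ => integrable_finsetSum _ fun j _ => hi i j]
    exact Finset.sum_congr rfl fun i _ => (integral_finsetSum _ fun j _ => hi i j).symm

lemma hasConicalForm_iff_hasConicalPotential {T : TensorDist} {f : ℝ → ℝ}
    (hf : IsSmoothPeriodic f) : HasConicalForm T f ↔ HasConicalPotential T f := by
  rw [hasConicalForm_iff hf]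
  constructor
  · rintro ⟨hT, h0⟩
    obtain ⟨g, hg, hgf⟩ := exists_potential hf h0
    have hW : ∀ φ : Test, ofDensity (cone g) φ = ∫ x : Plane, ‖x‖ * g (angle x) * φ x := fun φ =>
      ofDensity_apply (locallyIntegrable_cone hg) φ
    refine ⟨g, hg, hgf, ofDensity (cone g), hW, ?_⟩
    ext i j φ
    rw [hT, hess_apply_eq_integral hg hW, funext hgf]
  · rintro ⟨g, hg, hgf, W, hW, rfl⟩
    obtain rfl : (fun θ => g θ + iteratedDeriv 2 g θ) = f := funext hgf
    exact ⟨hess_apply_eq_integral hg hW, integral_eTheta_eq_zero hg⟩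

lemma HasConicalPotential.tensorCurl_eq_zero {T : TensorDist} {f : ℝ → ℝ}
    (h : HasConicalPotential T f) : tensorCurl T = 0 := by
  obtain ⟨g, -, -, W, -, rfl⟩ := h
  exact tensorCurl_hess W

lemma HasConicalPotential.exists_isDet {T : TensorDist} {f : ℝ → ℝ}
    (h : HasConicalPotential T f) : ∃ D, IsDet T D := by
  obtain ⟨g, hg, -, W, hW, rfl⟩ := h
  exact ConicalPlate.exists_isDet hg hW

lemma contDiffOn_conicalField {f : ℝ → ℝ} (hf : IsSmoothPeriodic f) (i j : Fin 2) :
    ContDiffOn ℝ ∞ (conicalField f i j) {0}ᶜ := by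
  have hn : ContDiffOn ℝ ∞ (fun x : Plane => ‖x‖) {0}ᶜ := fun x hx =>
    (contDiffAt_norm ℝ hx).contDiffWithinAt
  exact ((contDiffOn_comp_angle hf).div hn fun x hx => norm_ne_zero_iff.2 hx).mul
    (contDiffOn_comp_angle ((isSmoothPeriodic_eTheta i).mul (isSmoothPeriodic_eTheta j)))

lemma HasConicalForm.det_eq_zero {T : TensorDist} {f : ℝ → ℝ} (hf : IsSmoothPeriodic f)
    (h : HasConicalForm T f) {t : Plane → Matrix (Fin 2) (Fin 2) ℝ}
    (ht : HasSmoothTensorDensityOn T {0}ᶜ t) {x : Plane} (hx : x ≠ 0) : (t x).det = 0 := by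
  have h1 : ∀ i j, t x i j = conicalField f i j x := fun i j =>
    (ht i j).eqOn isOpen_punctured (s := conicalField f i j) ⟨contDiffOn_conicalField hf i j,
      fun φ _ => ((hasConicalForm_iff hf).1 h).1 i j φ⟩ hx
  rw [Matrix.det_fin_two, h1, h1, h1, h1]
  simp only [conicalField]
  ring

/-! ### The curl of a conical field -/

/-- A radial test function, equal to `1` near the origin. -/
def radialBump : Test where
  toFun x := Real.smoothTransition (2 - ‖x‖ ^ 2)
  contDiff' := Real.smoothTransition.contDiff.comp (contDiff_const.sub (contDiff_norm_sq ℝ))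
  hasCompactSupport' := HasCompactSupport.intro (isCompact_closedBall (0 : Plane) 2) fun x hx => by
    rw [mem_closedBall_zero_iff, not_le] at hx
    exact Real.smoothTransition.zero_of_nonpos (by nlinarith)
  tsupport_subset' := by simp

/-- The radial profile of the radial test function. -/
def bumpProfile (r : ℝ) : ℝ := Real.smoothTransition (2 - r ^ 2)

lemma contDiff_bumpProfile : ContDiff ℝ ∞ bumpProfile :=
  Real.smoothTransition.contDiff.comp (contDiff_const.sub (contDiff_id.pow 2))

lemma integral_deriv_bumpProfile : ∫ r in Ioi (0 : ℝ), deriv bumpProfile r = -1 := by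
  have hc : HasCompactSupport bumpProfile :=
    HasCompactSupport.intro (isCompact_Icc (a := (-2 : ℝ)) (b := 2)) fun x hx => by
      refine Real.smoothTransition.zero_of_nonpos ?_
      by_contra h
      rw [not_le] at h
      exact hx ⟨by nlinarith, by nlinarith⟩
  rw [hc.integral_Ioi_deriv_eq (contDiff_bumpProfile.of_le (by exact_mod_cast le_top)) 0,
    bumpProfile, Real.smoothTransition.one_of_one_le (by norm_num)]

lemma fderiv_radialBump {x : Plane} (hx : x ≠ 0) (i : Fin 2) :
    fderiv ℝ radialBump x (e i) = deriv bumpProfile ‖x‖ * (x i / ‖x‖) := by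
  have h1 : HasDerivAt (fun r : ℝ => 2 - r ^ 2) (-(2 * ‖x‖)) ‖x‖ := by
    simpa using ((hasDerivAt_id ‖x‖).pow 2).const_sub 2
  have h2 : HasDerivAt Real.smoothTransition (deriv Real.smoothTransition (2 - ‖x‖ ^ 2))
      (2 - ‖x‖ ^ 2) :=
    ((Real.smoothTransition.contDiff (n := 1)).differentiable (by simp) _).hasDerivAt
  have h3 : deriv bumpProfile ‖x‖ = _ := (h2.comp ‖x‖ h1).deriv
  have h4 := h2.comp_hasFDerivAt x ((hasStrictFDerivAt_norm_sq x).hasFDerivAt.const_sub 2)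
  have h5 : fderiv ℝ radialBump x = _ := h4.fderiv
  have hr : ‖x‖ ≠ 0 := norm_ne_zero_iff.2 hx
  rw [h5, h3]
  have h6 : inner ℝ x (e i) = x i := by
    rw [e, EuclideanSpace.inner_single_right]
    simp
  simp [h6]
  field_simp

/-- Integration of products in polar coordinates. -/
lemma integral_angle_mul_norm (h k : ℝ → ℝ) :
    ∫ x : Plane, h (angle x) * k ‖x‖ =
      (∫ r in Ioi (0 : ℝ), r * k r) * ∫ θ in Ioo (-Real.pi) Real.pi, h θ := by
  have h1 := Complex.orthonormalBasisOneI.measurePreserving_repr.integral_comp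
    Complex.orthonormalBasisOneI.repr.toHomeomorph.measurableEmbedding
    (fun x : Plane => h (angle x) * k ‖x‖)
  rw [← h1, ← Complex.integral_comp_polarCoord_symm]
  have h2 : ∀ p ∈ polarCoord.target,
      p.1 • (h (angle (Complex.orthonormalBasisOneI.repr (Complex.polarCoord.symm p))) *
        k ‖Complex.orthonormalBasisOneI.repr (Complex.polarCoord.symm p)‖) =
      (p.1 * k p.1) * h p.2 := by
    intro p hp
    rw [polarCoord_target] at hp
    have hr : 0 < p.1 := hp.1
    have hz : angle (Complex.orthonormalBasisOneI.repr (Complex.polarCoord.symm p)) =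
        Complex.arg (Complex.polarCoord.symm p) := by
      rw [angle]
      congr 1
    rw [hz, LinearIsometryEquiv.norm_map, Complex.polarCoord_symm_apply]
    have hn : ‖(p.1 : ℂ) * (Real.cos p.2 + Real.sin p.2 * Complex.I)‖ = p.1 := by
      rw [Complex.ofReal_cos, Complex.ofReal_sin, norm_mul, Complex.norm_cos_add_sin_mul_I, mul_one,
        Complex.norm_real, Real.norm_of_nonneg hr.le]
    have ha : Complex.arg ((p.1 : ℂ) * (Real.cos p.2 + Real.sin p.2 * Complex.I)) = p.2 := by
      rw [Complex.ofReal_cos, Complex.ofReal_sin]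
      exact Complex.arg_mul_cos_add_sin_mul_I hr (Ioo_subset_Ioc_self hp.2)
    rw [hn, ha, smul_eq_mul]
    ring
  rw [setIntegral_congr_fun polarCoord.open_target.measurableSet h2, polarCoord_target,
    Measure.volume_eq_prod, setIntegral_prod_mul (fun r => r * k r) h]

/-- If a conical field is curl-free, then its angular part is orthogonal to sine and cosine. -/
lemma integral_eq_zero_of_tensorCurl_eq_zero {T : TensorDist} {f : ℝ → ℝ}
    (hf : IsSmoothPeriodic f) (hT : ∀ i j φ, T i j φ = ∫ x, conicalField f i j x * φ x)
    (hcurl : tensorCurl T = 0) (i : Fin 2) :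
    ∫ θ in (0 : ℝ)..(2 * Real.pi), f θ * eTheta θ i = 0 := by
  have h1 : tensorCurl T i radialBump = 0 := by
    rw [hcurl]
    rfl
  have h2 : tensorCurl T i radialBump =
      (∂_{e 0} (T i 1)) radialBump - (∂_{e 1} (T i 0)) radialBump := rfl
  rw [h2, lineDeriv_dist_apply, lineDeriv_dist_apply, hT, hT] at h1
  have hi : ∀ j k, Integrable fun x => conicalField f i j x * (∂_{e k} radialBump : Test) x :=
    fun j k => integrable_mul_test (locallyIntegrable_conicalField hf i j) _
  have h3 : ∫ x, (conicalField f i 1 x * (∂_{e 0} radialBump : Test) x -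
      conicalField f i 0 x * (∂_{e 1} radialBump : Test) x) = 0 := by
    rw [integral_sub (hi 1 0) (hi 0 1)]
    linarith
  -- For a radial test function the gradient is along `e_R`, so the curl pairing separates into an
  -- angular and a radial factor. The radial one is the integral of the derivative of the profile,
  -- namely `-1`.
  have h4 : ∫ x : Plane, (f (angle x) * eTheta (angle x) i) * (deriv bumpProfile ‖x‖ / ‖x‖) = 0 := by
    rw [← h3]
    refine integral_congr_ae ?_
    have h0 : ∀ᵐ x : Plane, x ≠ 0 := by simp [ae_iff]
    filter_upwards [h0] with x hx
    rw [lineDeriv_test_apply, lineDeriv_test_apply, fderiv_radialBump hx, fderiv_radialBump hx,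
      coord_zero_eq x, coord_one_eq x]
    have hr : ‖x‖ ≠ 0 := norm_ne_zero_iff.2 hx
    have h5 : eTheta (angle x) 0 = -Real.sin (angle x) := rfl
    have h6 : eTheta (angle x) 1 = Real.cos (angle x) := rfl
    rw [conicalField, conicalField, h5, h6]
    field_simp
    linear_combination (-f (angle x) * eTheta (angle x) i * deriv bumpProfile ‖x‖) *
      Real.sin_sq_add_cos_sq (angle x)
  rw [integral_angle_mul_norm (fun θ => f θ * eTheta θ i) (fun r => deriv bumpProfile r / r)] at h4
  have h5 : ∫ r in Ioi (0 : ℝ), r * (deriv bumpProfile r / r) = -1 := by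
    rw [← integral_deriv_bumpProfile]
    refine setIntegral_congr_fun measurableSet_Ioi fun r hr => ?_
    exact mul_div_cancel₀ _ (ne_of_gt hr)
  rw [h5] at h4
  -- Polar coordinates use the angles in `(-π, π)`; periodicity shifts the integral to `[0, 2π]`.
  have h6 := (hf.mul (isSmoothPeriodic_eTheta i)).2.intervalIntegral_add_eq (-Real.pi) 0
  rw [zero_add, show -Real.pi + 2 * Real.pi = Real.pi by ring,
    intervalIntegral.integral_of_le (by linarith [Real.pi_pos]), integral_Ioc_eq_integral_Ioo] at h6
  rw [← h6]
  linarith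

/-! ### Developable tensor distributions are conical -/

/-- The unit vector at polar angle `θ`. -/
def circlePoint (θ : ℝ) : Plane := !₂[Real.cos θ, Real.sin θ]

lemma circlePoint_ne_zero (θ : ℝ) : circlePoint θ ≠ 0 := by
  rw [ne_zero_iff_coord]
  by_contra! h
  have h0 : Real.cos θ = 0 := h.1
  have h1 : Real.sin θ = 0 := h.2
  have := Real.sin_sq_add_cos_sq θ
  rw [h0, h1] at this
  norm_num at this

lemma contDiff_circlePoint : ContDiff ℝ ∞ circlePoint := by
  rw [contDiff_euclidean]
  intro i
  fin_cases i
  · exact Real.contDiff_cos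
  · exact Real.contDiff_sin

lemma norm_smul_circlePoint (x : Plane) : ‖x‖ • circlePoint (angle x) = x :=
  plane_ext (coord_zero_eq x).symm (coord_one_eq x).symm

/-- A symmetric matrix with `e_R` in its kernel is its trace times `e_θ ⊗ e_θ`. So `f` is the trace
on the unit circle, and homogeneity supplies the factor `1 / r`. -/
lemma IsDevelopable.exists_conicalField {M : Plane → Matrix (Fin 2) (Fin 2) ℝ}
    (hM : IsDevelopable M) (h : ∀ x, x ≠ 0 → ∀ i, row M x i x = 0) :
    ∃ f, IsSmoothPeriodic f ∧ ∀ x, x ≠ 0 → ∀ i j, M x i j = conicalField f i j x := by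
  have hs : ∀ i, ContDiff ℝ ∞ fun θ => M (circlePoint θ) i i := fun i => by
    rw [← contDiffOn_univ]
    exact (hM.smooth i i).comp contDiff_circlePoint.contDiffOn fun θ _ => circlePoint_ne_zero θ
  have hp : Function.Periodic circlePoint (2 * Real.pi) := fun θ => by simp [circlePoint]
  refine ⟨fun θ => M (circlePoint θ) 0 0 + M (circlePoint θ) 1 1, ⟨(hs 0).add (hs 1), fun θ => by
    simp only [hp θ]⟩, fun x hx i j => ?_⟩
  have hr : 0 < ‖x‖ := norm_pos_iff.2 hx
  have h1 := hM.smul_of_radial h (circlePoint_ne_zero (angle x)) hr i j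
  rw [norm_smul_circlePoint] at h1
  have h2 := h _ (circlePoint_ne_zero (angle x))
  have h3 : M (circlePoint (angle x)) i j =
      (M (circlePoint (angle x)) 0 0 + M (circlePoint (angle x)) 1 1) *
        (eTheta (angle x) i * eTheta (angle x) j) := by
    have ha := h2 0
    have hb := h2 1
    have hsy := hM.symm _ (circlePoint_ne_zero (angle x))
    have h0 : circlePoint (angle x) 0 = Real.cos (angle x) := rfl
    have h1 : circlePoint (angle x) 1 = Real.sin (angle x) := rfl
    have hsc := Real.sin_sq_add_cos_sq (angle x)
    rw [row, h0, h1] at ha hb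
    rw [hsy] at hb
    have k00 : M (circlePoint (angle x)) 0 0 = (M (circlePoint (angle x)) 0 0 +
        M (circlePoint (angle x)) 1 1) * (eTheta (angle x) 0 * eTheta (angle x) 0) := by
      simp only [eTheta, Matrix.cons_val_zero]
      linear_combination Real.cos (angle x) * ha - Real.sin (angle x) * hb -
        M (circlePoint (angle x)) 0 0 * hsc
    have k01 : M (circlePoint (angle x)) 0 1 = (M (circlePoint (angle x)) 0 0 +
        M (circlePoint (angle x)) 1 1) * (eTheta (angle x) 0 * eTheta (angle x) 1) := by
      simp only [eTheta, Matrix.cons_val_zero, Matrix.cons_val_one]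
      linear_combination Real.sin (angle x) * ha + Real.cos (angle x) * hb -
        M (circlePoint (angle x)) 0 1 * hsc
    have k11 : M (circlePoint (angle x)) 1 1 = (M (circlePoint (angle x)) 0 0 +
        M (circlePoint (angle x)) 1 1) * (eTheta (angle x) 1 * eTheta (angle x) 1) := by
      simp only [eTheta, Matrix.cons_val_one, Matrix.cons_val_fin_one]
      linear_combination Real.sin (angle x) * hb - Real.cos (angle x) * ha -
        M (circlePoint (angle x)) 1 1 * hsc
    fin_cases i <;> fin_cases j
    · exact k00
    · exact k01
    · exact (hsy.trans k01).trans (by rw [mul_comm (eTheta (angle x) 0)]; rfl)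
    · exact k11
  change M x i j = (M (circlePoint (angle x)) 0 0 + M (circlePoint (angle x)) 1 1) / ‖x‖ *
    (eTheta (angle x) i * eTheta (angle x) j)
  rw [div_mul_eq_mul_div, eq_div_iff hr.ne', ← h3, ← h1, mul_comm]

/-- Negative degree excludes any additional part of `T` at the origin, so agreement almost
everywhere with a smooth field suffices. -/
lemma hasSmoothTensorDensityOn_univ {T : TensorDist} (hdeg : tensorDegree T < 0)
    {t s : Plane → Matrix (Fin 2) (Fin 2) ℝ} (ht : HasSmoothTensorDensityOn T {0}ᶜ t)
    (hs : ∀ i j, ContDiff ℝ ∞ fun x => s x i j) (hst : ∀ᵐ x, s x = t x) :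
    HasSmoothTensorDensityOn T univ s := by
  intro i j
  refine ⟨(hs i j).contDiffOn, fun φ _ => ?_⟩
  refine apply_eq_integral (tendsto_halve_iterate_of_degree_neg hdeg (i, j))
    (hs i j).continuous.locallyIntegrable (fun φ hφ => ?_) φ
  rw [(ht i j).2 φ hφ]
  refine integral_congr_ae ?_
  filter_upwards [hst] with x hx
  rw [hx]

/-- Of the two arrangements of rulings, the parallel one would make the singular support empty, by
minimality of `{0}`. In the radial one the curl condition at the origin, not only off it, yields the
orthogonality of `f`. -/
lemma exists_hasConicalForm {T : TensorDist} {t : Plane → Matrix (Fin 2) (Fin 2) ℝ}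
    (hsymm : T.IsSymm) (hdeg : tensorDegree T < 0) (hsing : IsSingularSupport T {0})
    (ht : HasSmoothTensorDensityOn T {0}ᶜ t) (hne : ∀ x, x ≠ 0 → t x ≠ 0)
    (hdet : ∀ x, x ≠ 0 → (t x).det = 0) (hcurl : tensorCurl T = 0) :
    ∃ f, IsSmoothPeriodic f ∧ HasConicalForm T f := by
  have hM : IsDevelopable t :=
    { smooth := fun i j => (ht i j).1
      symm := fun x hx => by
        have h := ht 1 0
        rw [hsymm.apply 0 1] at h
        exact h.eqOn isOpen_punctured (ht 0 1) hx
      curl := fun x hx i => by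
        have h := (ht.tensorCurl isOpen_punctured i).eqOn_zero isOpen_punctured
          (fun φ _ => by rw [hcurl]; rfl) hx
        exact sub_eq_zero.1 h
      det := hdet
      ne := hne }
  rcases hM.radial_or_parallel with h | ⟨v, hv0, hv⟩
  · obtain ⟨f, hf, hft⟩ := hM.exists_conicalField h
    have hT : ∀ i j φ, T i j φ = ∫ x, conicalField f i j x * φ x := fun i j φ =>
      apply_eq_integral (tendsto_halve_iterate_of_degree_neg hdeg (i, j))
        (locallyIntegrable_conicalField hf i j)
        ((ht i j).congr fun x hx => (hft x hx i j).symm).2 φ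
    exact ⟨f, hf, (hasConicalForm_iff hf).2
      ⟨hT, integral_eq_zero_of_tensorCurl_eq_zero hf hT hcurl⟩⟩
  · exfalso
    obtain ⟨s, hs, hst⟩ := hM.exists_smooth_of_parallel hv0 hv
    have h : ({0} : Set Plane) ⊆ ∅ := hsing.2 ⟨isClosed_empty, s, by
      rw [compl_empty]
      exact hasSmoothTensorDensityOn_univ hdeg ht hs hst⟩
    exact h (mem_singleton (0 : Plane))

end ConicalPlate

end

theorem mainTheorem5 (Λ : ConicalPlate.TensorDist)
    (lam : ConicalPlate.Plane → Matrix (Fin 2) (Fin 2) ℝ)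
    (hsymm : Λ.IsSymm)
    (hdeg : ConicalPlate.tensorDegree Λ < 0)
    (hsing : ConicalPlate.IsSingularSupport Λ {0})
    (hlam : ConicalPlate.HasSmoothTensorDensityOn Λ {0}ᶜ lam)
    (hne : ∀ x, x ≠ 0 → lam x ≠ 0) :
    List.TFAE
      [(∃ D, ConicalPlate.IsDet Λ D ∧ Distribution.IsVanishingOn D {0}ᶜ) ∧
          ConicalPlate.tensorCurl Λ = 0,
        (∀ x, x ≠ 0 → (lam x).det = 0) ∧ ConicalPlate.tensorCurl Λ = 0,
        ∃ f, ConicalPlate.IsSmoothPeriodic f ∧ ConicalPlate.HasConicalForm Λ f,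
        ∃ f, ConicalPlate.IsSmoothPeriodic f ∧ ConicalPlate.HasConicalPotential Λ f] ∧
    ∀ f, ConicalPlate.IsSmoothPeriodic f →
      (ConicalPlate.HasConicalForm Λ f ↔ ConicalPlate.HasConicalPotential Λ f) := by
  have hdet : (∃ D, ConicalPlate.IsDet Λ D ∧ Distribution.IsVanishingOn D {0}ᶜ) →
      ∀ x, x ≠ 0 → (lam x).det = 0 := by
    rintro ⟨D, hD, h0⟩ x hx
    exact (hD.hasSmoothDensityOn hlam).eqOn_zero ConicalPlate.isOpen_punctured h0 hx
  refine ⟨?_, fun f hf => ConicalPlate.hasConicalForm_iff_hasConicalPotential hf⟩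
  tfae_have 1 → 2 := fun h => ⟨hdet h.1, h.2⟩
  tfae_have 2 → 3 := fun h =>
    ConicalPlate.exists_hasConicalForm hsymm hdeg hsing hlam hne h.1 h.2
  tfae_have 3 ↔ 4 := exists_congr fun f => and_congr_right fun hf =>
    ConicalPlate.hasConicalForm_iff_hasConicalPotential hf
  tfae_have 4 → 1 := by
    rintro ⟨f, hf, h⟩
    obtain ⟨D, hD⟩ := h.exists_isDet
    refine ⟨⟨D, hD, (hD.hasSmoothDensityOn hlam).isVanishingOn fun x hx => ?_⟩,
      h.tensorCurl_eq_zero⟩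
    exact ((ConicalPlate.hasConicalForm_iff_hasConicalPotential hf).2 h).det_eq_zero hf hlam hx
  tfae_finish
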